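/- For a group $T$ write $[a,b]=a^{-1}b^{-1}ab$ and $b^a=a^{-1}ba$. Let $\{1\}=Z_0(T)\le Z_1(T)=Z(T)\le Z_2(T)\le\cdots$ be the upper central series of $T$, and for $n\ge 1$ let $T^n$ be the subgroup of $T$ generated by all $t^n$ with $t\in T$. For $\alpha\in\mathbb Z$ let $$G(\alpha)=\langle x,y \mid x^{[x,y]}=x^{\alpha},\ y^{[y,x]}=y^{\alpha}\rangle$$ be the Macdonald group. Suppose that $3$ divides $\alpha-1$ exactly once, i.e. $v_3(\alpha-1)=1$, and that $(\alpha-1)/3\equiv -1 \pmod 3$. Let $J$ be the Sylow $3$-subgroup of $G(\alpha)$. Then $J$ is generated by two elements $A,B$ satisfying $A^{[A,B]}=A^{\alpha}$ and $B^{[B,A]}=B^{\alpha}$, and for every such pair of generators $A,B$ of $J$, with $C=[A,B]$, the following hold. (a) $Z_5(J)=\langle A^3,B^3,C^3\rangle=J^3$, and $J/Z_5(J)\cong \mathrm{Heis}(\mathbb Z/3\mathbb Z)$, the group of upper unitriangular $3\times 3$ matrices over $\mathbb Z/3\mathbb Z$. (b) $Z_3(J)=\langle A^9,B^9,C^9\rangle=J^9$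 is abelian of exponent $9$, and $Z_5(J)/Z_3(J)\cong(\mathbb Z/3\mathbb Z)^3$. (c) $Z(J)=\langle A^{27}\rangle=J^{27}$, and the exponent of $J$ is equal to $81$. -/

import Mathlib

namespace MacdonaldGroup

/-- The commutator `[a, b] = a⁻¹ b⁻¹ a b` (this differs from Mathlib's `⁅a, b⁆ = a b a⁻¹ b⁻¹`). -/
def comm {T : Type*} [Group T] (a b : T) : T := a⁻¹ * b⁻¹ * a * b

/-- The conjugate `b ^ a = a⁻¹ b a`. -/
def conjBy {T : Type*} [Group T] (b a : T) : T := a⁻¹ * b * a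

/-- The relators of the Macdonald group: `x ^ [x, y] = x ^ α` and `y ^ [y, x] = y ^ α`, where
`x` and `y` are the free generators. -/
def relators (α : ℤ) : Set (FreeGroup (Fin 2)) :=
  let x : FreeGroup (Fin 2) := FreeGroup.of 0
  let y : FreeGroup (Fin 2) := FreeGroup.of 1
  {conjBy x (comm x y) * (x ^ α)⁻¹, conjBy y (comm y x) * (y ^ α)⁻¹}

/-- The Macdonald group `G(α) = ⟨x, y | x ^ [x, y] = x ^ α, y ^ [y, x] = y ^ α⟩`. -/
abbrev Macdonald (α : ℤ) : Type := PresentedGroup (relators α)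

/-- `A` and `B` generate the group `T` and satisfy
`A ^ [A, B] = A ^ α` and `B ^ [B, A] = B ^ α`. -/
structure IsGeneratingPair (α : ℤ) {T : Type*} [Group T] (A B : T) : Prop where
  generate : Subgroup.closure {A, B} = ⊤
  rel_left : conjBy A (comm A B) = A ^ α
  rel_right : conjBy B (comm B A) = B ^ α

/-- `T ^ n`: the subgroup of `T` generated by all `n`-th powers of elements of `T`. -/
def powerSubgroup (T : Type*) [Group T] (n : ℕ) : Subgroup T :=
  Subgroup.closure (Set.range fun t : T => t ^ n)

/-- The Heisenberg group over `R`: the triple `(a, b, c)` stands for the upper unitriangular matrix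
`!![1, a, c; 0, 1, b; 0, 0, 1]`. -/
@[ext]
structure Heis (R : Type*) where
  a : R
  b : R
  c : R

namespace Heis

variable {R : Type*} [CommRing R]

instance : Mul (Heis R) := ⟨fun g h => ⟨g.a + h.a, g.b + h.b, g.c + h.c + g.a * h.b⟩⟩

instance : One (Heis R) := ⟨⟨0, 0, 0⟩⟩

instance : Inv (Heis R) := ⟨fun g => ⟨-g.a, -g.b, -g.c + g.a * g.b⟩⟩

theorem mul_def (g h : Heis R) : g * h = ⟨g.a + h.a, g.b + h.b, g.c + h.c + g.a * h.b⟩ := rfl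

theorem one_def : (1 : Heis R) = ⟨0, 0, 0⟩ := rfl

theorem inv_def (g : Heis R) : g⁻¹ = ⟨-g.a, -g.b, -g.c + g.a * g.b⟩ := rfl

instance : Group (Heis R) :=
  Group.ofLeftAxioms
    (fun g h k => by ext <;> simp only [mul_def] <;> ring)
    (fun g => by ext <;> simp only [mul_def, one_def] <;> ring)
    (fun g => by ext <;> simp only [mul_def, one_def, inv_def] <;> ring)

/-- The matrix that an element of the Heisenberg group stands for. -/
def toMatrix (g : Heis R) : Matrix (Fin 3) (Fin 3) R := !![1, g.a, g.c; 0, 1, g.b; 0, 0, 1]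

theorem toMatrix_mul (g h : Heis R) : (g * h).toMatrix = g.toMatrix * h.toMatrix := by
  ext i j
  fin_cases i <;> fin_cases j <;>
    simp [toMatrix, mul_def, Matrix.mul_apply, Fin.sum_univ_three] <;> ring

theorem toMatrix_injective : Function.Injective (toMatrix : Heis R → _) := by
  intro g h hgh
  have h1 := congrFun (congrFun hgh 0) 1
  have h2 := congrFun (congrFun hgh 1) 2
  have h3 := congrFun (congrFun hgh 0) 2
  simp [toMatrix] at h1 h2 h3
  exact Heis.ext h1 h2 h3

end Heis

end MacdonaldGroup

/-! Put `C = [A, B]`. The relations say that conjugation by `C` raises `A` to the power `α` and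
conjugation by `C⁻¹` raises `B` to the power `α`. Hence `B⁻¹ A ^ n B = A ^ n C ^ n A ^ d` with `d =
defect α n`. If `n` and `m` are powers of `α` (or congruent to such powers modulo the orders of `A`
and `B`), then `[A ^ m, B ^ n]` can be evaluated from either side. The comparison,
`MacRel.fundamental`, reads `B ^ f C ^ K A ^ f = C ^ K` and forces `A ^ f` and `B ^ f` to be central
and mutually inverse, with `A ^ ((α - 1) f) = 1` (`MacRel.central_of_fundamental`).

This gives that `A` and `B` have finite order, that only primes dividing `α - 1` occur
(`MacRel.prime_dvd_sub_one`), that the group is torsion (`MacRel.torsion`), and that a Sylow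
subgroup is generated by the primary components of the two generators, which satisfy the same
relations (`sylow_eq_closure`).

Here `α ≡ 7 mod 9`, and `f` can be chosen with 3-adic valuation exactly 3, so in a 3-group `A ^ 81 =
B ^ 81 = C ^ 27 = A ^ 27 B ^ 27 = 1` (`MacRel.threePair`). Let `P s = powSub A B C s` and `M s =
midSub A B C s`. In the chain `G = P 0 ≥ M 0 ≥ P 1 ≥ ⋯ ≥ P 3 = ⟨A ^ 27⟩ ≥ M 3 = 1` every factor is
central, by `[A ^ 3 ^ s, B] ≡ C ^ 3 ^ s` modulo `P (s + 1)` and `[A, C ^ 3 ^ s] = A ^ (3 ^ (s + 1)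
w)` with `3 ∤ w`. The same formulas show that the chain is the upper central series once its steps
are proper, and properness climbs from the bottom: everything follows from `A ^ 27 ≠ 1`. That
inequality is read off from an explicit permutation group (`exists_model`), and it does not depend
on the generating pair (`ThreePair.left_pow_ne_one`). -/

namespace MacdonaldGroup

/-! ### Divisibility of geometric sums and of the defect -/

/-- `1 + α + ⋯ + α ^ (n - 1)`. -/
def geo (α : ℤ) (n : ℕ) : ℤ := ∑ i ∈ Finset.range n, α ^ i

/-- `α + 2 α ^ 2 + ⋯ + (n - 1) α ^ (n - 1)`. -/
def wgeo (α : ℤ) (n : ℕ) : ℤ := ∑ i ∈ Finset.range n, (i : ℤ) * α ^ i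

/-- The exponent that measures the failure of `A ^ n ↦ A ^ n C ^ n` under conjugation by `B`. -/
def defect (α : ℤ) (n : ℕ) : ℤ := α * geo α n - n * α ^ n

@[simp] theorem geo_zero (α : ℤ) : geo α 0 = 0 := rfl

theorem geo_succ (α : ℤ) (n : ℕ) : geo α (n + 1) = α * geo α n + 1 := by
  rw [geo, Finset.sum_range_succ', geo, Finset.mul_sum]
  simp [pow_succ, mul_comm]

theorem geo_succ' (α : ℤ) (n : ℕ) : geo α (n + 1) = geo α n + α ^ n := Finset.sum_range_succ _ _

theorem sub_one_mul_geo (α : ℤ) (n : ℕ) : (α - 1) * geo α n = α ^ n - 1 := mul_geom_sum α n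

theorem geo_add (α : ℤ) (m n : ℕ) : geo α (m + n) = geo α m + α ^ m * geo α n := by
  simp [geo, Finset.sum_range_add, pow_add, Finset.mul_sum]

theorem geo_mul (α : ℤ) (m n : ℕ) : geo α (m * n) = geo α m * geo (α ^ m) n := by
  induction n with
  | zero => simp
  | succ n ih => rw [Nat.mul_succ, geo_add, ih, geo_succ', pow_mul]; ring

theorem wgeo_succ (α : ℤ) (n : ℕ) : wgeo α (n + 1) = wgeo α n + n * α ^ n :=
  Finset.sum_range_succ _ _

theorem wgeo_add (α : ℤ) (m n : ℕ) :
    wgeo α (m + n) = wgeo α m + α ^ m * (m * geo α n + wgeo α n) := by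
  induction n with
  | zero => simp [wgeo]
  | succ n ih =>
    rw [← add_assoc, wgeo_succ, ih, wgeo_succ, geo_succ', pow_add]; push_cast; ring

theorem wgeo_mul (α : ℤ) (m n : ℕ) :
    wgeo α (m * n) = wgeo α m * geo (α ^ m) n + m * geo α m * wgeo (α ^ m) n := by
  induction n with
  | zero => simp [wgeo]
  | succ n ih =>
    rw [Nat.mul_succ, wgeo_add, ih, geo_succ', wgeo_succ, pow_mul]; push_cast; ring

/-- This extracts the factor `α - 1`, which is what makes the defect of `n` more divisible than `n`
itself. -/
theorem defect_eq (α : ℤ) (n : ℕ) : defect α n = -((α - 1) * wgeo α n) := by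
  induction n with
  | zero => simp [defect, wgeo]
  | succ n ih =>
    have h : defect α (n + 1) = defect α n - (α - 1) * (n * α ^ n) := by
      simp only [defect, geo_succ']; push_cast; ring
    rw [h, ih, wgeo_succ]; ring

theorem defect_succ (α : ℤ) (n : ℕ) :
    defect α (n + 1) = α * defect α n - α * (α - 1) * geo α n := by
  have := sub_one_mul_geo α n
  simp only [defect, geo_succ, pow_succ]; push_cast
  linear_combination α * this

theorem sub_one_mul_defect (α : ℤ) (n : ℕ) :
    (α - 1) * defect α n = α ^ n * (α - (α - 1) * n) - α := by
  have := sub_one_mul_geo α n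
  simp only [defect]
  linear_combination α * this

theorem modEq_one_of_pow {α : ℤ} {q : ℤ} (h : q ∣ α - 1) (m : ℕ) : q ∣ α ^ m - 1 :=
  h.trans (by simpa using sub_dvd_pow_sub_pow α 1 m)

theorem dvd_geo_self {α q : ℤ} (h : q ∣ α - 1) (n : ℕ) : q ∣ geo α n - n := by
  induction n with
  | zero => simp
  | succ n ih =>
    have h2 := dvd_add ih (modEq_one_of_pow h n)
    rw [geo_succ', show geo α n + α ^ n - ((n + 1 : ℕ) : ℤ) = geo α n - n + (α ^ n - 1) by push_cast; ring]
    exact h2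

theorem dvd_two_mul_wgeo {α q : ℤ} (h : q ∣ α - 1) (n : ℕ) :
    q ∣ 2 * wgeo α n - n * (n - 1) := by
  induction n with
  | zero => simp [wgeo]
  | succ n ih =>
    have h2 := dvd_add ih ((modEq_one_of_pow h n).mul_left (2 * n))
    rw [wgeo_succ, show 2 * (wgeo α n + n * α ^ n) - ((n + 1 : ℕ) : ℤ) * (((n + 1 : ℕ) : ℤ) - 1) =
      2 * wgeo α n - n * (n - 1) + 2 * n * (α ^ n - 1) by push_cast; ring]
    exact h2

/-- Cutting a sum of length `a * b` into blocks reduces to prime length, where `α ≡ 1` gives `geo ≡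
p` and `2 wgeo ≡ p (p - 1)` modulo `p`. The factor 2 is needed for `p = 2`. -/
theorem dvd_geo_and_wgeo {α : ℤ} {n : ℕ} (hn : n ≠ 0)
    (h : ∀ p : ℕ, p.Prime → p ∣ n → (p : ℤ) ∣ α - 1) :
    (n : ℤ) ∣ geo α n ∧ (n : ℤ) ∣ 2 * wgeo α n := by
  induction n using Nat.recOnMul generalizing α with
  | zero => exact absurd rfl hn
  | one => simp
  | prime p hp =>
    have hpd := h p hp dvd_rfl
    refine ⟨?_, ?_⟩
    · simpa using dvd_add (dvd_geo_self hpd p) dvd_rfl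
    · have := dvd_add (dvd_two_mul_wgeo hpd p) (Dvd.intro ((p : ℤ) - 1) rfl)
      simpa using this
  | mul a b iha ihb =>
    have ha : a ≠ 0 := left_ne_zero_of_mul hn
    have hb : b ≠ 0 := right_ne_zero_of_mul hn
    obtain ⟨a1, a2⟩ := iha ha fun p hp hpa => h p hp (hpa.mul_right b)
    -- The sum over the blocks has base `α ^ a`, which is still 1 modulo the primes in question.
    obtain ⟨b1, b2⟩ := ihb (α := α ^ a) hb fun p hp hpb =>
      modEq_one_of_pow (h p hp (hpb.mul_left a)) a
    rw [geo_mul, wgeo_mul, Nat.cast_mul]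
    refine ⟨mul_dvd_mul a1 b1, ?_⟩
    rw [mul_add]
    refine dvd_add ?_ ?_
    · rw [← mul_assoc]; exact mul_dvd_mul a2 b1
    · rw [show 2 * ((a : ℤ) * geo α a * wgeo (α ^ a) b) =
        geo α a * (a * (2 * wgeo (α ^ a) b)) by ring]
      exact (mul_dvd_mul_left _ b2).mul_left _

theorem dvd_geo {α : ℤ} {n : ℕ} (hn : n ≠ 0)
    (h : ∀ p : ℕ, p.Prime → p ∣ n → (p : ℤ) ∣ α - 1) : (n : ℤ) ∣ geo α n :=
  (dvd_geo_and_wgeo hn h).1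

/-- Every geometric sum whose length is divisible by `n` is divisible by `n`. -/
theorem dvd_geo_of_dvd {α : ℤ} {n m : ℕ} (hn : n ≠ 0)
    (h : ∀ p : ℕ, p.Prime → p ∣ n → (p : ℤ) ∣ α - 1) (hm : n ∣ m) : (n : ℤ) ∣ geo α m := by
  obtain ⟨c, rfl⟩ := hm
  rw [geo_mul]
  exact (dvd_geo hn h).mul_right _

theorem dvd_pow_sub_one {α : ℤ} {n m : ℕ} (hn : n ≠ 0)
    (h : ∀ p : ℕ, p.Prime → p ∣ n → (p : ℤ) ∣ α - 1) (hm : n ∣ m) : (n : ℤ) ∣ α ^ m - 1 := by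
  rw [← sub_one_mul_geo]
  exact (dvd_geo_of_dvd hn h hm).mul_left _

theorem dvd_defect {α : ℤ} {n : ℕ} (hn : n ≠ 0)
    (h : ∀ p : ℕ, p.Prime → p ∣ n → (p : ℤ) ∣ α - 1) : (n : ℤ) ∣ defect α n :=
  dvd_sub ((dvd_geo hn h).mul_left _) (Dvd.intro _ rfl)

end MacdonaldGroup

/-! ### Consequences of the relations and the fundamental identity -/

namespace MacdonaldGroup

variable {G : Type*} [Group G]

/-- The relations of the Macdonald group, with `C` playing the role of `[A, B]`. -/
structure MacRel (α : ℤ) (A B C : G) : Prop where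
  comm : A * B = B * A * C
  left : A * C = C * A ^ α
  right : C * B = B ^ α * C

theorem macRel_iff {α : ℤ} {A B : G} : MacRel α A B (comm A B) ↔
    conjBy A (comm A B) = A ^ α ∧ conjBy B (comm B A) = B ^ α := by
  have hi : comm B A = (comm A B)⁻¹ := by simp [comm, mul_assoc]
  constructor
  · rintro ⟨-, h1, h2⟩
    refine ⟨?_, ?_⟩
    · rw [conjBy, mul_assoc, h1, inv_mul_cancel_left]
    · rw [hi, conjBy, inv_inv, h2, mul_inv_cancel_right]
  · rintro ⟨h1, h2⟩
    refine ⟨by simp [comm, mul_assoc], ?_, ?_⟩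
    · rw [← h1]; simp [conjBy, mul_assoc]
    · rw [← h2, hi]; simp [conjBy, mul_assoc]

namespace MacRel

variable {α : ℤ} {A B C : G}

theorem eq_comm (h : MacRel α A B C) : C = MacdonaldGroup.comm A B := by
  rw [MacdonaldGroup.comm, mul_assoc, h.comm]; group

/-- This symmetry halves the work throughout: each fact about `A` gives one about `B`. -/
theorem symm (h : MacRel α A B C) : MacRel α B A C⁻¹ where
  comm := by rw [h.comm]; group
  left := by
    rw [eq_inv_mul_iff_mul_eq, ← mul_assoc, h.right, mul_inv_cancel_right]
  right := by
    rw [inv_mul_eq_iff_eq_mul, ← mul_assoc, ← h.left, mul_inv_cancel_right]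

theorem map {H : Type*} [Group H] (f : G →* H) (h : MacRel α A B C) :
    MacRel α (f A) (f B) (f C) where
  comm := by simp only [← map_mul, h.comm]
  left := by simp only [← map_mul, ← map_zpow, h.left]
  right := by simp only [← map_mul, ← map_zpow, h.right]

theorem of_injective {H : Type*} [Group H] {f : G →* H} (hf : Function.Injective f)
    (h : MacRel α (f A) (f B) (f C)) : MacRel α A B C where
  comm := hf (by simpa using h.comm)
  left := hf (by simpa using h.left)
  right := hf (by simpa using h.right)

theorem congr_exponent (h : MacRel α A B C) {β : ℤ} (hA : A ^ α = A ^ β) (hB : B ^ α = B ^ β) :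
    MacRel β A B C :=
  ⟨h.comm, hA ▸ h.left, hB ▸ h.right⟩

/-- Powers of `A` move past `C`. -/
theorem zpow_mul_pow (h : A * C = C * A ^ α) (x : ℤ) (n : ℕ) :
    A ^ x * C ^ n = C ^ n * A ^ (x * α ^ n) := by
  have h1 : ∀ y : ℤ, A ^ y * C = C * A ^ (y * α) := fun y => by
    have : C⁻¹ * A * C = A ^ α := by rw [mul_assoc, h, inv_mul_cancel_left]
    rw [mul_comm y, zpow_mul, ← this]
    have h3 := conj_zpow (i := y) (a := C⁻¹) (b := A)
    rw [inv_inv] at h3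
    rw [h3]; group
  induction n generalizing x with
  | zero => simp
  | succ n ih =>
    rw [pow_succ, ← mul_assoc, ih, mul_assoc, h1, ← mul_assoc]; congr 2; ring

theorem mul_pow_eq (h : A * C = C * A ^ α) (x : ℤ) (n : ℕ) :
    (A ^ x * C) ^ n = C ^ n * A ^ (x * α * geo α n) := by
  induction n with
  | zero => simp
  | succ n ih =>
    have h1 := zpow_mul_pow h (x * α * geo α n + x) 1
    simp only [pow_one] at h1
    rw [pow_succ, ih, mul_assoc, ← mul_assoc (A ^ _), ← zpow_add, h1, ← mul_assoc, ← pow_succ,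
      geo_succ]
    congr 2; ring

/-- `C ^ n` moves past powers of `B`. -/
theorem pow_mul_zpow (h : C * B = B ^ α * C) (x : ℤ) (n : ℕ) :
    C ^ n * B ^ x = B ^ (x * α ^ n) * C ^ n := by
  have h1 : B * C⁻¹ = C⁻¹ * B ^ α := by
    rw [eq_inv_mul_iff_mul_eq, ← mul_assoc, h, mul_inv_cancel_right]
  have h2 := zpow_mul_pow h1 x n
  rw [inv_pow, mul_inv_eq_iff_eq_mul, mul_assoc, eq_inv_mul_iff_mul_eq] at h2
  exact h2

theorem mul_pow_eq' (h : C * B = B ^ α * C) (x : ℤ) (n : ℕ) :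
    (B ^ x * C) ^ n = B ^ (x * geo α n) * C ^ n := by
  induction n with
  | zero => simp
  | succ n ih =>
    rw [pow_succ, ih, mul_assoc, ← mul_assoc (C ^ n), pow_mul_zpow h, mul_assoc, ← pow_succ,
      ← mul_assoc, ← zpow_add, geo_succ']
    congr 2; ring

/-- Conjugation by powers of an element `D` that acts on `a`, `b` and `t` like `b` does in the
Macdonald relations. -/
theorem mul_pow_of_act {D a b t : G} (hr : t * b = b ^ α * t) (hb : Commute D b)
    (ha : a * D = D * (a * t)) (ht : t * D = D * (b ^ (α - 1) * t)) (n : ℕ) :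
    a * D ^ n = D ^ n * (a * b ^ (-defect α n) * t ^ n) := by
  have hc : ∀ x y : G, x * D = D * y → D⁻¹ * x * D = y := fun x y hxy => by
    rw [mul_assoc, hxy, inv_mul_cancel_left]
  have conj : ∀ x : G, D⁻¹ * x * D = MulAut.conj D⁻¹ x := fun x => by simp
  induction n with
  | zero => simp [defect]
  | succ n ih =>
    have key : D⁻¹ * (a * b ^ (-defect α n) * t ^ n) * D =
        a * b ^ (-defect α (n + 1)) * t ^ (n + 1) := by
      rw [conj, map_mul, map_mul, map_zpow, map_pow, ← conj, ← conj, ← conj, hc _ _ ha,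
        hc _ _ ht, hc _ _ hb.symm, mul_pow_eq' hr]
      have h1 := pow_mul_zpow hr (-defect α n) 1
      simp only [pow_one] at h1
      have h2 := pow_mul_zpow hr ((α - 1) * geo α n) 1
      simp only [pow_one] at h2
      rw [mul_assoc a t, h1, mul_assoc a, mul_assoc (b ^ _) t, ← mul_assoc t, h2, mul_assoc _ t,
        ← pow_succ', ← mul_assoc (b ^ _) (b ^ _), ← zpow_add, ← mul_assoc]
      congr 3
      rw [defect_succ]; ring
    rw [pow_succ, ← mul_assoc, ih, mul_assoc, mul_assoc (D ^ n), ← key]; group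

theorem mul_right_gen (h : MacRel α A B C) : C * B = B * (B ^ (α - 1) * C) := by
  rw [h.right, ← mul_assoc, ← zpow_one_add]; congr 2; ring

theorem mul_pow_right (h : MacRel α A B C) (n : ℕ) :
    A * B ^ n = B ^ n * (A * B ^ (-defect α n) * C ^ n) :=
  mul_pow_of_act h.right (Commute.refl B) (by rw [h.comm, mul_assoc]) h.mul_right_gen n

theorem pow_mul_right (h : MacRel α A B C) (n : ℕ) :
    A ^ n * B = B * (C ^ n * A ^ (α * geo α n)) := by
  have h1 : B⁻¹ * A * B = A * C := by rw [mul_assoc, h.comm]; group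
  have h2 := conj_pow (i := n) (a := B⁻¹) (b := A)
  rw [inv_inv, h1] at h2
  have h3 := mul_pow_eq h.left 1 n
  rw [zpow_one, one_mul, h2] at h3
  rw [← h3]; group

/-- Both `(A ^ m) ^ (B ^ n)` and `(B ^ n) ^ (A ^ m)` are computable. -/
theorem comm_pow_pow (h : MacRel α A B C) {i n m : ℕ}
    (hB : C ^ i * B = B ^ n * C ^ i) (hA : A * C ^ i = C ^ i * A ^ n) :
    A ^ m * B ^ n = B ^ n * A ^ m * (C ^ (i + n * m) * A ^ defect α (n * m) * (C ^ i)⁻¹) := by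
  have hBn : B ^ n = C ^ i * B * (C ^ i)⁻¹ := by rw [hB, mul_inv_cancel_right]
  have hAn : (C ^ i)⁻¹ * A * C ^ i = A ^ n := by rw [mul_assoc, hA, inv_mul_cancel_left]
  have hAm : (C ^ i)⁻¹ * A ^ m * C ^ i = A ^ (n * m) := by
    have := conj_pow (i := m) (a := (C ^ i)⁻¹) (b := A)
    rw [inv_inv, hAn, ← pow_mul] at this
    exact this.symm
  -- Since `B ^ n` and `B` are conjugate under `C ^ i`, moving `B ^ n` past `A ^ m` becomes moving
  -- `B` past `A ^ (n * m)`.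
  have h4 : A ^ m * B ^ n = C ^ i * (A ^ (n * m) * B) * (C ^ i)⁻¹ := by
    rw [hBn, ← hAm]; group
  have h5 : A ^ (n * m) * C ^ (n * m) = C ^ (n * m) * A ^ (((n * m : ℕ) : ℤ) * α ^ (n * m)) := by
    have := zpow_mul_pow h.left ((n * m : ℕ) : ℤ) (n * m)
    rwa [zpow_natCast] at this
  have h6 : B ^ n * A ^ m * (C ^ (i + n * m) * A ^ defect α (n * m) * (C ^ i)⁻¹) =
      C ^ i * B * ((C ^ i)⁻¹ * A ^ m * C ^ i) * C ^ (n * m) * A ^ defect α (n * m)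
        * (C ^ i)⁻¹ := by
    rw [hBn, pow_add]; group
  rw [h6, hAm, h4, h.pow_mul_right, mul_assoc _ (A ^ (n * m)), h5, defect, sub_eq_neg_add, zpow_add,
    zpow_neg]
  group

/-- The two evaluations of `[A ^ m, B ^ n]` compared. -/
theorem fundamental (h : MacRel α A B C) {i j n m : ℕ}
    (hBn : C ^ i * B = B ^ n * C ^ i) (hAn : A * C ^ i = C ^ i * A ^ n)
    (hBm : C ^ j * B = B ^ m * C ^ j) (hAm : A * C ^ j = C ^ j * A ^ m) :
    B ^ defect α (n * m) * C ^ (i + j + n * m) * A ^ defect α (n * m) = C ^ (i + j + n * m) := by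
  have h1 := h.comm_pow_pow (m := m) hBn hAn
  -- The swapped pair evaluates `[B ^ n, A ^ m]`, the inverse of the commutator in `h1`.
  have h2 := h.symm.comm_pow_pow (i := j) (n := m) (m := n)
    (by rw [inv_pow, inv_mul_eq_iff_eq_mul, ← mul_assoc, ← hAm, mul_inv_cancel_right])
    (by rw [inv_pow, eq_inv_mul_iff_mul_eq, ← mul_assoc, hBm, mul_inv_cancel_right])
  rw [h2, mul_assoc, left_eq_mul, mul_comm m n] at h1
  calc _ = C ^ (j + n * m) * (C⁻¹ ^ (j + n * m) * B ^ defect α (n * m) * (C⁻¹ ^ j)⁻¹ *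
      (C ^ (i + n * m) * A ^ defect α (n * m) * (C ^ i)⁻¹)) * C ^ i := by
        rw [add_comm i j, add_assoc, pow_add C j]; group
    _ = _ := by rw [h1, mul_one, ← pow_add]; congr 1; ring

section Central

variable {K : ℕ} {f : ℤ}

/-- The identity makes `A ^ f` the conjugate of `B ^ (-f)` by `C ^ K`. Raising it to the power `α ^
K` undoes this conjugation, so `B ^ f` is a power of `A`. -/
theorem commute_of_fundamental (h : MacRel α A B C) (hf : B ^ f * C ^ K * A ^ f = C ^ K) :
    Commute A (B ^ f) := by
  have h1 : A ^ f = (C ^ K)⁻¹ * B ^ (-f) * C ^ K := by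
    rw [zpow_neg, mul_assoc, eq_inv_mul_iff_mul_eq, eq_inv_mul_iff_mul_eq, ← mul_assoc, hf]
  have h2 : A ^ (f * α ^ K) = B ^ (-f) := by
    have := conj_zpow (i := α ^ K) (a := (C ^ K)⁻¹) (b := B ^ (-f))
    rw [inv_inv, ← h1, ← zpow_mul, ← zpow_mul, mul_assoc, ← pow_mul_zpow h.right,
      inv_mul_cancel_left] at this
    exact this
  have h3 : B ^ f = A ^ (-(f * α ^ K)) := by rw [zpow_neg, h2, zpow_neg, inv_inv]
  rw [h3]
  exact Commute.zpow_right rfl _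

theorem fundamental_symm (hf : B ^ f * C ^ K * A ^ f = C ^ K) :
    A ^ f * C⁻¹ ^ K * B ^ f = C⁻¹ ^ K := by
  rw [inv_pow]
  conv_lhs => rw [← hf]
  group

theorem commute_C_of_commute (h : MacRel α A B C) {z : G} (hA : Commute A z) (hB : Commute B z) :
    Commute C z := by
  rw [h.eq_comm, MacdonaldGroup.comm]
  exact ((hA.inv_left.mul_left hB.inv_left).mul_left hA).mul_left hB

/-- Once `A ^ f` and `B ^ f` are central, `C ^ K` cancels from the identity, and conjugation by `C`,
which multiplies exponents by `α`, must fix them. -/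
theorem central_of_fundamental (h : MacRel α A B C) (hf : B ^ f * C ^ K * A ^ f = C ^ K) :
    Commute B (A ^ f) ∧ Commute A (B ^ f) ∧ A ^ f * B ^ f = 1 ∧
      A ^ ((α - 1) * f) = 1 ∧ B ^ ((α - 1) * f) = 1 := by
  have hA := h.commute_of_fundamental hf
  have hB := h.symm.commute_of_fundamental (fundamental_symm hf)
  have hCA := h.commute_C_of_commute (Commute.zpow_right rfl f) hB
  have hCB := h.commute_C_of_commute hA (Commute.zpow_right rfl f)
  refine ⟨hB, hA, ?_, ?_, ?_⟩
  · have := hCB.pow_left K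
    rw [← this.eq, mul_assoc, mul_eq_left] at hf
    rw [← hf]
    exact hA.zpow_left f
  · have h1 := zpow_mul_pow h.left f 1
    rw [pow_one, pow_one, ← hCA.eq, mul_left_cancel_iff] at h1
    rw [sub_mul, one_mul, zpow_sub, mul_comm, ← h1, mul_inv_cancel]
  · have h1 := pow_mul_zpow h.right f 1
    rw [pow_one, pow_one, hCB.eq, mul_right_cancel_iff] at h1
    rw [sub_mul, one_mul, zpow_sub, mul_comm, ← h1, mul_inv_cancel]

end Central

end MacRel
end MacdonaldGroup

/-! ### Finiteness of the orders of the generators and their prime divisors -/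

namespace MacdonaldGroup

theorem zpow_congr {G : Type*} [Group G] {M : ℕ} {g : G} (hg : g ^ M = 1) {x y : ℤ} (hxy : (M : ℤ) ∣ x - y) : g ^ x = g ^ y := by
  obtain ⟨c, hc⟩ := hxy
  rw [show x = y + M * c by linarith, zpow_add, zpow_mul, zpow_natCast, hg, one_zpow, mul_one]

namespace MacRel

variable {G : Type*} [Group G] {α : ℤ} {A B C : G}

/-- If `d` divides both `α` and the order of `g`, then `g ^ (order / d)` is conjugate to its `α`-th
power, which is trivial; so `d = 1`. -/
theorem orderOf_coprime {g c : G} (h : g * c = c * g ^ α) (hg : 0 < orderOf g) :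
    IsCoprime α (orderOf g : ℤ) := by
  have h1 : c⁻¹ * g * c = g ^ α := by rw [mul_assoc, h, inv_mul_cancel_left]
  rw [Int.isCoprime_iff_gcd_eq_one]
  obtain ⟨a, ha⟩ := Int.gcd_dvd_left α (orderOf g : ℤ)
  obtain ⟨b, hb⟩ := Int.gcd_dvd_right α (orderOf g : ℤ)
  set d := Int.gcd α (orderOf g : ℤ)
  have h2 : g ^ b = 1 := by
    have h3 : (g ^ α) ^ b = 1 := by
      rw [← zpow_mul, ha, mul_right_comm, ← hb, zpow_mul, zpow_natCast, pow_orderOf_eq_one,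
        one_zpow]
    have h4 := conj_zpow (i := b) (a := c⁻¹) (b := g)
    rw [inv_inv, h1, h3] at h4
    have h5 : g ^ b = c * (c⁻¹ * g ^ b * c) * c⁻¹ := by group
    rw [h5, ← h4]; group
  obtain ⟨e, he⟩ := orderOf_dvd_iff_zpow_eq_one.mpr h2
  have hb0 : b ≠ 0 := by
    rintro rfl
    rw [mul_zero] at hb
    exact hg.ne' (by exact_mod_cast hb)
  have h6 : b * ((d : ℤ) * e - 1) = 0 := by rw [hb] at he; linear_combination -he
  have h7 : (d : ℤ) * e = 1 := by
    have := (mul_eq_zero.mp h6).resolve_left hb0; linarith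
  have := Int.isUnit_iff_natAbs_eq.mp (IsUnit.of_mul_eq_one _ h7)
  simpa using this

/-- `A` and `B` have finite order. -/
theorem exists_pow_eq_one (h : MacRel α A B C) (h0 : 2 ≤ |α|) :
    ∃ n : ℕ, 0 < n ∧ A ^ n = 1 ∧ B ^ n = 1 := by
  have e1 : ((α ^ 2).natAbs : ℤ) = α ^ 2 := by
    rw [Int.natCast_natAbs, abs_of_nonneg (sq_nonneg α)]
  have hB : C ^ 2 * B = B ^ (α ^ 2).natAbs * C ^ 2 := by
    have := pow_mul_zpow h.right 1 2
    rw [zpow_one, one_mul, ← e1, zpow_natCast] at this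
    exact this
  have hA : A * C ^ 2 = C ^ 2 * A ^ (α ^ 2).natAbs := by
    have := zpow_mul_pow h.left 1 2
    rw [zpow_one, one_mul, ← e1, zpow_natCast] at this
    exact this
  -- Here `n = m = α ^ 2` and `i = j = 2`: the square is a natural number whatever the sign of `α`.
  obtain ⟨-, -, -, h1, h2⟩ := h.central_of_fundamental (h.fundamental hB hA hB hA)
  set k := (α ^ 2).natAbs * (α ^ 2).natAbs
  have hne : (α - 1) * defect α k ≠ 0 := by
    rw [sub_one_mul_defect]
    intro h3
    have hk : 2 ≤ k := by
      have h4 : α ^ 2 = |α| ^ 2 := (sq_abs α).symm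
      have : 4 ≤ (α ^ 2).natAbs := by zify; rw [abs_of_nonneg (sq_nonneg α), h4]; nlinarith
      show 2 ≤ (α ^ 2).natAbs * (α ^ 2).natAbs
      nlinarith
    obtain ⟨l, hl⟩ := Nat.exists_eq_add_of_le hk
    have h5 : α * (α * (α ^ l * (α - (α - 1) * k)) - 1) = 0 := by
      rw [← h3, show α ^ k = α ^ (2 + l) by rw [hl], pow_add]; ring
    have hα : α ≠ 0 := by rintro rfl; simp at h0
    -- A vanishing exponent would make `α` a unit of `ℤ`.
    have h6 : α * (α ^ l * (α - (α - 1) * k)) = 1 := by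
      have := (mul_eq_zero.mp h5).resolve_left hα
      linarith
    have h7 := Int.isUnit_iff_abs_eq.mp (IsUnit.of_mul_eq_one _ h6)
    omega
  refine ⟨((α - 1) * defect α k).natAbs, Int.natAbs_pos.mpr hne, ?_, ?_⟩
  · rwa [pow_natAbs_eq_one]
  · rwa [pow_natAbs_eq_one]

section Finite
variable {M : ℕ}

/-- The fundamental relation for exponents that are congruent to a power of `α`. -/
theorem central_of_modEq (h : MacRel α A B C) (hA : A ^ M = 1) (hB : B ^ M = 1) {l n : ℕ}
    (hn : (M : ℤ) ∣ (n : ℤ) - α ^ l) :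
    Commute B (A ^ defect α n) ∧ Commute A (B ^ defect α n) ∧
      A ^ defect α n * B ^ defect α n = 1 ∧
      A ^ ((α - 1) * defect α n) = 1 ∧ B ^ ((α - 1) * defect α n) = 1 := by
  have h1 : C ^ l * B = B ^ n * C ^ l := by
    have := pow_mul_zpow h.right 1 l
    rwa [zpow_one, one_mul, ← zpow_congr hB hn, zpow_natCast] at this
  have h2 : A * C ^ l = C ^ l * A ^ n := by
    have := zpow_mul_pow h.left 1 l
    rwa [zpow_one, one_mul, ← zpow_congr hA hn, zpow_natCast] at this
  have := h.central_of_fundamental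
    (h.fundamental (i := l) (j := 0) (n := n) (m := 1) h1 h2 (by simp) (by simp))
  rwa [mul_one] at this

/-- Every prime divisor of the orders of `A` and `B` divides `α - 1`. -/
theorem prime_dvd_sub_one (h : MacRel α A B C) (hα : 2 ≤ |α|) :
    ∃ M : ℕ, 0 < M ∧ A ^ M = 1 ∧ B ^ M = 1 ∧
      ∀ p : ℕ, p.Prime → p ∣ M → (p : ℤ) ∣ α - 1 := by
  obtain ⟨N, hN, hAN, hBN⟩ := h.exists_pow_eq_one hα
  have hA0 : 0 < orderOf A := orderOf_pos_iff.mpr (isOfFinOrder_iff_pow_eq_one.mpr ⟨N, hN, hAN⟩)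
  have hB0 : 0 < orderOf B := orderOf_pos_iff.mpr (isOfFinOrder_iff_pow_eq_one.mpr ⟨N, hN, hBN⟩)
  have hcA := orderOf_coprime h.left hA0
  have hcB := orderOf_coprime h.symm.left hB0
  set M := Nat.lcm (orderOf A) (orderOf B) with hM
  have hM0 : 0 < M := Nat.lcm_pos hA0 hB0
  have hAM : A ^ M = 1 := orderOf_dvd_iff_pow_eq_one.mp (Nat.dvd_lcm_left _ _)
  have hBM : B ^ M = 1 := orderOf_dvd_iff_pow_eq_one.mp (Nat.dvd_lcm_right _ _)
  have hcop : IsCoprime α (M : ℤ) := by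
    refine (hcA.mul_right hcB).of_isCoprime_of_dvd_right ?_
    exact_mod_cast Nat.lcm_dvd_mul _ _
  have key : ∀ l n : ℕ, (M : ℤ) ∣ (n : ℤ) - α ^ l → (M : ℤ) ∣ α ^ n * (α - (α - 1) * n) - α := by
    intro l n hn
    obtain ⟨-, -, -, h1, h2⟩ := h.central_of_modEq hAM hBM hn
    rw [← sub_one_mul_defect, Int.natCast_dvd]
    exact Nat.lcm_dvd (Int.natCast_dvd.mp (orderOf_dvd_iff_zpow_eq_one.mpr h1))
      (Int.natCast_dvd.mp (orderOf_dvd_iff_zpow_eq_one.mpr h2))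
  have hαM : (M : ℤ) ∣ α ^ M - 1 := by
    -- With `l = 0` and `n = M + 1` the divisibility reads `α ^ (M + 1) ≡ α` modulo `M`.
    have h1 := key 0 (M + 1) (by simp)
    have h2 : (M : ℤ) ∣ α * (α ^ M - 1) := by
      obtain ⟨c, hc⟩ := h1
      refine ⟨c + (α - 1) * α ^ (M + 1), ?_⟩
      push_cast at hc
      linear_combination hc
    exact hcop.symm.dvd_of_dvd_mul_left h2
  refine ⟨M, hM0, hAM, hBM, fun p hp hpM => ?_⟩
  have := Fact.mk hp
  have hpM' : (p : ℤ) ∣ M := Int.natCast_dvd_natCast.mpr hpM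
  have cast_eq : ∀ {x y : ℤ}, (p : ℤ) ∣ x - y → (x : ZMod p) = y := fun hxy =>
    ((ZMod.intCast_eq_intCast_iff_dvd_sub _ _ _).mpr hxy).symm
  set a : ZMod p := (α : ZMod p) with ha
  have haM : a ^ M = 1 := by
    have := cast_eq (hpM'.trans hαM); push_cast at this; exact this
  have ha0 : a ≠ 0 := by
    intro h0; rw [h0, zero_pow hM0.ne'] at haM; exact zero_ne_one haM
  set d := orderOf a with hd
  have hdM : d ∣ M := orderOf_dvd_of_pow_eq_one haM
  have hd0 : 0 < d := Nat.pos_of_dvd_of_pos hdM hM0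
  -- By Euler `α ^ l ≡ 1` modulo the order `d` of `a`. So for `n ≡ α ^ l` modulo `M` both `a ^ n =
  -- a` and `n ≡ a ^ l` modulo `p`, and `key` becomes `(a - 1) (1 - a ^ l) = 0` in the field.
  set l := Nat.totient d
  have hαd : (d : ℤ) ∣ α ^ l - 1 := by
    have h1 : IsCoprime α (d : ℤ) :=
      hcop.of_isCoprime_of_dvd_right (Int.natCast_dvd_natCast.mpr hdM)
    obtain ⟨u, hu⟩ := (ZMod.coe_int_isUnit_iff_isCoprime α d).mpr h1.symm
    have h2 : ((α ^ l : ℤ) : ZMod d) = (1 : ℤ) := by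
      push_cast; rw [← hu, ← Units.val_pow_eq_pow_val, ZMod.pow_totient, Units.val_one]
    exact (ZMod.intCast_eq_intCast_iff_dvd_sub _ _ _).mp h2.symm
  obtain ⟨n, hn⟩ : ∃ n : ℕ, (M : ℤ) ∣ (n : ℤ) - α ^ l := by
    refine ⟨(α ^ l % M).toNat, ?_⟩
    rw [Int.toNat_of_nonneg (Int.emod_nonneg _ (by exact_mod_cast hM0.ne'))]
    exact (Int.mod_modEq _ _).symm.dvd
  have hn1 : a ^ n = a := by
    have h1 : (d : ℤ) ∣ (n : ℤ) - 1 := by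
      have := dvd_add ((Int.natCast_dvd_natCast.mpr hdM).trans hn) hαd
      simpa using this
    have h2 : a ^ n = a ^ 1 := by
      have h3 : n ≡ 1 [MOD d] :=
        (Int.natCast_modEq_iff.mp ((Int.modEq_iff_dvd.mpr (by simpa using h1)))).symm
      rw [← pow_mod_orderOf, h3, pow_mod_orderOf]
    rw [h2, pow_one]
  have hna : (n : ZMod p) = a ^ l := by
    have := cast_eq (hpM'.trans hn); push_cast at this; exact this
  have h3 : a * (a - (a - 1) * a ^ l) = a := by
    have := cast_eq (hpM'.trans (key l n hn))
    push_cast at this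
    rwa [← ha, hn1, hna] at this
  have h4 : (a - 1) * (1 - a ^ l) = 0 := by
    have := mul_left_cancel₀ ha0 (h3.trans (mul_one a).symm)
    linear_combination this
  have h5 : a = 1 := by
    rcases mul_eq_zero.mp h4 with h5 | h5
    · exact sub_eq_zero.mp h5
    -- The order `d` cannot divide `φ(d)` unless `d = 1`.
    · have h6 : d ∣ l := orderOf_dvd_of_pow_eq_one (sub_eq_zero.mp h5).symm
      have h7 : ¬ 1 < d := fun h8 =>
        absurd (Nat.le_of_dvd (Nat.totient_pos.mpr hd0) h6) (not_le.mpr (Nat.totient_lt d h8))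
      exact orderOf_eq_one_iff.mp (by omega)
  refine (ZMod.intCast_eq_intCast_iff_dvd_sub 1 α p).mp ?_
  rw [Int.cast_one, ← ha, h5]

end Finite
end MacRel
end MacdonaldGroup

/-! ### The group is torsion -/

namespace MacdonaldGroup

universe u

theorem commute_of_closure_eq_top {G : Type*} [Group G] {A B z : G}
    (hgen : Subgroup.closure {A, B} = ⊤) (hA : Commute A z) (hB : Commute B z) (g : G) :
    Commute g z := by
  have hle : Subgroup.closure {A, B} ≤ Subgroup.centralizer {z} := by
    rw [Subgroup.closure_le]
    rintro x (rfl | rfl) <;> simp only [SetLike.mem_coe, Subgroup.mem_centralizer_singleton_iff]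
    exacts [hA, hB]
  have : g ∈ Subgroup.centralizer {z} := hle (hgen ▸ Subgroup.mem_top g)
  exact Subgroup.mem_centralizer_singleton_iff.mp this

theorem closure_map_eq_top {G H : Type*} [Group G] [Group H] {A B : G}
    (hgen : Subgroup.closure {A, B} = ⊤) {f : G →* H} (hf : Function.Surjective f) :
    Subgroup.closure {f A, f B} = ⊤ := by
  rw [← Set.image_pair, ← MonoidHom.map_closure, hgen, Subgroup.map_top_of_surjective f hf]

theorem closure_subtype_eq_top {G : Type*} [Group G] {A B : G} {K : Subgroup G}
    (hK : K = Subgroup.closure {A, B}) (hA : A ∈ K) (hB : B ∈ K) :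
    Subgroup.closure {(⟨A, hA⟩ : K), ⟨B, hB⟩} = ⊤ := by
  apply Subgroup.map_injective K.subtype_injective
  rw [MonoidHom.map_closure, Set.image_pair, ← MonoidHom.range_eq_map, Subgroup.range_subtype]
  exact hK.symm

/-- A power of `g` lies in `⟨z⟩`, and one more `M`-th power kills it. The hypothesis speaks of
arbitrary surjections killing `z`, so that central elements can be killed one after another. -/
theorem exists_pow_eq_one_of_central {G : Type u} [Group G] {M : ℕ} {z : G}
    (hz : ∀ g, Commute g z) (hzM : z ^ M = 1)
    (H : ∀ (Q : Type u) [Group Q] (f : G →* Q), Function.Surjective f → f z = 1 →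
      ∀ q : Q, ∃ j : ℕ, q ^ M ^ j = 1) (g : G) : ∃ j : ℕ, g ^ M ^ j = 1 := by
  have hn : (Subgroup.zpowers z).Normal := by
    refine ⟨fun n hn x => ?_⟩
    obtain ⟨k, rfl⟩ := Subgroup.mem_zpowers_iff.mp hn
    rw [((hz x).zpow_right k).eq, mul_inv_cancel_right]
    exact hn
  obtain ⟨j, hj⟩ := H (G ⧸ Subgroup.zpowers z) (QuotientGroup.mk' _)
    (QuotientGroup.mk'_surjective _)
    ((QuotientGroup.eq_one_iff z).mpr (Subgroup.mem_zpowers z)) (QuotientGroup.mk' _ g)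
  rw [← map_pow] at hj
  obtain ⟨k, hk⟩ := Subgroup.mem_zpowers_iff.mp ((QuotientGroup.eq_one_iff _).mp hj)
  refine ⟨j + 1, ?_⟩
  rw [pow_succ, pow_mul, ← hk, ← zpow_natCast, zpow_comm, zpow_natCast, hzM, one_zpow]

namespace MacRel

variable {G : Type*} [Group G] {α : ℤ} {A B C : G} {M : ℕ}

/-- Conjugating `A ^ M = 1` by `B` gives `C ^ M A ^ (α geo M) = 1`, and `M` divides the geometric
sum. -/
theorem pow_C_eq_one (h : MacRel α A B C) (hM : M ≠ 0) (hA : A ^ M = 1)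
    (hp : ∀ p : ℕ, p.Prime → p ∣ M → (p : ℤ) ∣ α - 1) : C ^ M = 1 := by
  have h1 := h.pow_mul_right M
  have h2 : A ^ (α * geo α M) = A ^ (0 : ℤ) :=
    zpow_congr hA (by rw [sub_zero]; exact (dvd_geo hM hp).mul_left _)
  rw [hA, h2, zpow_zero, mul_one, one_mul, left_eq_mul] at h1
  exact h1

/-- If `C ^ h = 1` and the orders of `A` and `B` divide `defect α h`, then `B ^ h` is central. -/
theorem commute_pow_right (h : MacRel α A B C) {n : ℕ} (hB : B ^ M = 1) (hC : C ^ n = 1)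
    (hM : (M : ℤ) ∣ defect α n) : Commute A (B ^ n) := by
  have h1 := h.mul_pow_right n
  rwa [hC, mul_one, zpow_neg, zpow_congr hB (x := defect α n) (y := 0) (by simpa using hM),
    zpow_zero, inv_one, mul_one] at h1

theorem commute_pow_C (h : MacRel α A B C) {n : ℕ} (hA : A ^ M = 1)
    (hM : (M : ℤ) ∣ α ^ n - 1) : Commute A (C ^ n) := by
  have h1 := zpow_mul_pow h.left 1 n
  rw [one_mul, zpow_congr hA hM, zpow_one] at h1
  exact h1

end MacRel

/-- The defect is `-(α - 1) wgeo n` with `n = M / p`, where `p` divides `α - 1` and `n` divides `2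
wgeo n`. For even `n` the spare 2 is recovered from `4 ∣ α - 1`. -/
theorem exists_dvd_defect {α : ℤ} {M p : ℕ} (hM : 1 < M) (hp : p = M.minFac)
    (h : ∀ p : ℕ, p.Prime → p ∣ M → (p : ℤ) ∣ α - 1)
    (h4 : ¬ (4 ∣ M ∧ ¬ (4 : ℤ) ∣ α - 1)) : (M : ℤ) ∣ defect α (M / p) := by
  have hpM : p ∣ M := hp ▸ M.minFac_dvd
  have hpp : p.Prime := hp ▸ Nat.minFac_prime hM.ne'
  obtain ⟨a, ha⟩ := h p hpp hpM
  set n := M / p with hn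
  have hnp : n * p = M := Nat.div_mul_cancel hpM
  have hn0 : n ≠ 0 := by rintro h0; rw [h0] at hnp; omega
  obtain ⟨c, hc⟩ := (dvd_geo_and_wgeo hn0 fun q hq hqn => h q hq (hqn.trans (Dvd.intro p hnp))).2
  rw [defect_eq, dvd_neg, ← hnp, Nat.cast_mul]
  by_cases hodd : 2 ∣ n
  · have hp2 : p = 2 := hp.trans ((Nat.minFac_eq_two_iff M).mpr (hodd.trans (Dvd.intro p hnp)))
    have hM4 : 4 ∣ M := by rw [← hnp, hp2]; exact mul_dvd_mul hodd dvd_rfl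
    obtain ⟨b, hb⟩ := not_not.mp fun hb => h4 ⟨hM4, hb⟩
    refine ⟨b * c, ?_⟩
    rw [hb, hp2]; push_cast
    linear_combination 2 * b * hc
  · have h2 : IsCoprime (n : ℤ) 2 := by
      rw [show (2 : ℤ) = ((2 : ℕ) : ℤ) from rfl, Nat.isCoprime_iff_coprime]
      exact (Nat.prime_two.coprime_iff_not_dvd.mpr hodd).symm
    obtain ⟨e, he⟩ := h2.dvd_of_dvd_mul_left ⟨c, hc⟩
    exact ⟨a * e, by rw [ha, he]; ring⟩

/-- For `α ≡ 3 mod 4`. As `n` is odd and `α ^ 2 ≡ 1 mod 8`, also `α ^ n ≡ α mod 8`, which determines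
the defect modulo 4. -/
theorem dvd_of_four {α : ℤ} {n : ℕ} (h2 : (2 : ℤ) ∣ α - 1) (h4 : ¬ (4 : ℤ) ∣ α - 1)
    (hn : (4 : ℤ) ∣ n - α) : ∃ d : ℤ, defect α n = 2 * d ∧ ¬ 2 ∣ d := by
  obtain ⟨x, hx⟩ : ∃ x : ℤ, α = 4 * x + 3 := ⟨α / 4, by omega⟩
  obtain ⟨y, hy⟩ : ∃ y : ℕ, n = 2 * y + 1 := ⟨n / 2, by omega⟩
  obtain ⟨z, hz⟩ : ∃ z : ℤ, (n : ℤ) = 4 * z + 3 := ⟨n / 4, by omega⟩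
  obtain ⟨w, hw⟩ : (8 : ℤ) ∣ α ^ n - α := by
    have h1 : (8 : ℤ) ∣ α ^ 2 - 1 := ⟨2 * x ^ 2 + 3 * x + 1, by rw [hx]; ring⟩
    rw [hy, pow_succ, pow_mul, ← sub_one_mul]
    exact (modEq_one_of_pow h1 y).mul_right _
  have h3 := sub_one_mul_defect α n
  obtain ⟨g, hg⟩ : (4 : ℤ) ∣ defect α n + α * (4 * z + 2) := by
    have hco : IsCoprime (4 : ℤ) (2 * x + 1) := ⟨-x ^ 2 - x, 2 * x + 1, by ring⟩
    refine hco.dvd_of_dvd_mul_left ⟨w * (α - (α - 1) * n), ?_⟩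
    rw [hz] at h3 ⊢
    have h5 : α - 1 = 2 * (2 * x + 1) := by rw [hx]; ring
    have h6 : 2 * ((2 * x + 1) * (defect α n + α * (4 * z + 2))) =
        2 * (4 * (w * (α - (α - 1) * (4 * z + 3)))) := by
      linear_combination h3 + (α - (α - 1) * (4 * z + 3)) * hw -
        (defect α n + α * (4 * z + 2)) * h5
    linarith
  refine ⟨2 * g - α * (2 * z + 1), by linear_combination hg, ?_⟩
  rintro ⟨e, he⟩
  have : (4 * x + 3) * (2 * z + 1) = 2 * (g - e) := by rw [← hx]; linear_combination -he
  have h7 : (4 * x + 3) * (2 * z + 1) = 2 * (4 * x * z + 2 * x + 3 * z + 1) + 1 := by ring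
  omega

/-- Let `p` be the least prime factor of `M` and `n = M / p`. Killing the central element `C ^ n`
makes `A ^ n` and `B ^ n` central, since `M` divides the defect of `n`; killing these as well
replaces `M` by `n`. When `4 ∣ M` and `4 ∤ α - 1`, that divisibility is not available, and `A ^ n`,
`B ^ n` are central by the fundamental identity at `k ≡ α`. -/
theorem MacRel.torsion {α : ℤ} (M : ℕ) : ∀ {G : Type u} [Group G] {A B C : G}, MacRel α A B C →
    Subgroup.closure {A, B} = ⊤ → M ≠ 0 → A ^ M = 1 → B ^ M = 1 →
    (∀ p : ℕ, p.Prime → p ∣ M → (p : ℤ) ∣ α - 1) → ∀ g : G, ∃ j : ℕ, g ^ M ^ j = 1 := by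
  induction M using Nat.strong_induction_on with
  | _ M ih =>
  intro G _ A B C h hgen hM0 hA hB hp g
  rcases Nat.lt_or_ge 1 M with hM1 | hM1
  swap
  · obtain rfl : M = 1 := by omega
    rw [pow_one] at hA hB
    rw [hA, hB] at hgen
    have : g ∈ Subgroup.closure {(1 : G), 1} := hgen ▸ Subgroup.mem_top g
    exact ⟨0, by simpa [Subgroup.closure_singleton_one] using this⟩
  set p := M.minFac with hpdef
  have hpp : p.Prime := Nat.minFac_prime hM1.ne'
  have hpM : p ∣ M := Nat.minFac_dvd M
  set n := M / p with hn
  have hnp : n * p = M := Nat.div_mul_cancel hpM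
  have hnM : n ∣ M := Dvd.intro p hnp
  have hn0 : n ≠ 0 := by rintro h0; rw [h0, zero_mul] at hnp; exact hM0 hnp.symm
  have hlt : n < M := Nat.div_lt_self (by omega) hpp.one_lt
  have hpn : ∀ q : ℕ, q.Prime → q ∣ n → (q : ℤ) ∣ α - 1 := fun q hq hqn => hp q hq (hqn.trans hnM)
  -- the quotient by `A ^ n` and `B ^ n`, if these are central
  have step : ∀ {H : Type u} [Group H] {A B C : H}, MacRel α A B C →
      Subgroup.closure {A, B} = ⊤ → A ^ M = 1 → B ^ M = 1 → Commute B (A ^ n) →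
      Commute A (B ^ n) → ∀ g : H, ∃ j : ℕ, g ^ M ^ j = 1 := by
    intro H _ A B C h hgen hA hB hBA hAB
    refine exists_pow_eq_one_of_central
      (commute_of_closure_eq_top hgen (Commute.pow_right rfl n) hBA)
      (by rw [← pow_mul, mul_comm, pow_mul, hA, one_pow]) fun Q _ f hf hfz => ?_
    have hgen' := closure_map_eq_top hgen hf
    refine exists_pow_eq_one_of_central
      (commute_of_closure_eq_top hgen' (z := f B ^ n) (by rw [← map_pow]; exact hAB.map f)
        (Commute.pow_right rfl n))
      (by rw [← pow_mul, mul_comm, pow_mul, ← map_pow, hB, map_one, one_pow])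
        fun Q' _ f' hf' hfz' q => ?_
    obtain ⟨j, hj⟩ := ih n hlt ((h.map f).map f') (closure_map_eq_top hgen' hf') hn0
      (by rw [← map_pow, ← map_pow, hfz, map_one]) (by rw [← map_pow, hfz']) hpn q
    refine ⟨j, ?_⟩
    obtain ⟨c, hc⟩ := pow_dvd_pow_of_dvd hnM j
    rw [hc, pow_mul, hj, one_pow]
  by_cases h4 : 4 ∣ M ∧ ¬ (4 : ℤ) ∣ α - 1
  · obtain ⟨h4, h4'⟩ := h4
    have hp2 : p = 2 := (Nat.minFac_eq_two_iff M).mpr ((by norm_num : 2 ∣ 4).trans h4)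
    obtain ⟨k, hk⟩ : ∃ k : ℕ, (M : ℤ) ∣ (k : ℤ) - α ^ 1 := by
      refine ⟨(α ^ 1 % M).toNat, ?_⟩
      rw [Int.toNat_of_nonneg (Int.emod_nonneg _ (by exact_mod_cast hM0))]
      exact (Int.mod_modEq _ _).symm.dvd
    obtain ⟨d, hd, hd2⟩ := dvd_of_four (n := k) (by simpa [hp2] using hp p hpp hpM) h4'
      ((Int.natCast_dvd_natCast.mpr h4).trans (by simpa using hk))
    obtain ⟨h1, h2, -⟩ := h.central_of_modEq hA hB hk
    obtain ⟨c, hc⟩ : ∃ c : ℤ, d = 2 * c + 1 := ⟨d / 2, by omega⟩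
    obtain ⟨m, hm⟩ : ∃ m : ℤ, (n : ℤ) = 2 * m := ⟨n / 2, by rw [hp2] at hnp; omega⟩
    -- The defect of `k` is `2 d` with `d` odd, and `n = 2 m`, so the right side is `x ^ (n d)`,
    -- which is `x ^ n` because `x ^ (2 n) = 1`.
    have hpow : ∀ {x : G}, x ^ M = 1 → x ^ n = (x ^ defect α k) ^ m := fun {x} hx => by
      rw [← zpow_mul, ← zpow_natCast]
      refine zpow_congr hx ⟨-c, ?_⟩
      rw [← hnp, hp2, hd, hc, Nat.cast_mul, hm]; push_cast; ring
    exact step h hgen hA hB (hpow hA ▸ h1.zpow_right m) (hpow hB ▸ h2.zpow_right m) g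
  · have hdef := exists_dvd_defect hM1 hpdef hp h4
    have hα : (M : ℤ) ∣ α ^ n - 1 := by
      rw [← sub_one_mul_geo, ← hnp, Nat.cast_mul, mul_comm (n : ℤ)]
      exact mul_dvd_mul (hp p hpp hpM) (dvd_geo hn0 hpn)
    refine exists_pow_eq_one_of_central (z := C ^ n)
      (commute_of_closure_eq_top hgen (h.commute_pow_C hA hα) ?_)
      (by rw [← pow_mul, mul_comm, pow_mul, h.pow_C_eq_one hM0 hA hp, one_pow])
      (fun Q _ f hf hfz => ?_) g
    · simpa using h.symm.commute_pow_C hB hα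
    · rw [map_pow] at hfz
      have hA' : f A ^ M = 1 := by rw [← map_pow, hA, map_one]
      have hB' : f B ^ M = 1 := by rw [← map_pow, hB, map_one]
      exact step (h.map f) (closure_map_eq_top hgen hf) hA' hB'
        ((h.map f).symm.commute_pow_right hA' (by rw [inv_pow, hfz, inv_one]) hdef)
        ((h.map f).commute_pow_right hB' hfz hdef)

end MacdonaldGroup

/-! ### Primary components of the generators and the Sylow subgroups -/

namespace MacdonaldGroup

universe u

/-- `e` is the idempotent modulo `P * Q` that is `1` modulo `P` and `0` modulo `Q`. -/
structure IsIdempotent (P Q e : ℕ) : Prop where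
  left : (P : ℤ) ∣ e - 1
  right : Q ∣ e

namespace IsIdempotent

variable {P Q e : ℕ} {α : ℤ}

theorem exists_of_coprime (h : P.Coprime Q) : ∃ e, IsIdempotent P Q e := by
  obtain ⟨e, h1, h2⟩ := Nat.chineseRemainder h 1 0
  exact ⟨e, by simpa using h1.symm.dvd, (Nat.modEq_zero_iff_dvd).mp h2⟩

theorem mul_dvd_of_coprime (h : P.Coprime Q) {x : ℤ} (h1 : (P : ℤ) ∣ x)
    (h2 : (Q : ℤ) ∣ x) : ((P * Q : ℕ) : ℤ) ∣ x := by
  push_cast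
  exact (Nat.isCoprime_iff_coprime.mpr h).mul_dvd h1 h2

/-- Modulo `Q` both terms vanish; modulo `P` the sum has length one more than a multiple of `P`. -/
theorem dvd_geo_sub (he : IsIdempotent P Q e) (h : P.Coprime Q) (hP : P ≠ 0) (hQ : Q ≠ 0)
    (hp : ∀ p : ℕ, p.Prime → p ∣ P * Q → (p : ℤ) ∣ α - 1) :
    ((P * Q : ℕ) : ℤ) ∣ geo α e - e := by
  refine mul_dvd_of_coprime h ?_ ?_
  · rcases Nat.eq_zero_or_pos e with rfl | h0
    · simp
    obtain ⟨c, rfl⟩ : ∃ c, e = c + 1 := ⟨e - 1, by omega⟩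
    have h1 : P ∣ c := by
      have := he.left; push_cast at this; simpa [Int.natCast_dvd_natCast] using this
    have h2 := dvd_geo_of_dvd hP (fun p hp1 hp2 => hp p hp1 (hp2.mul_right Q)) h1
    rw [geo_succ]; push_cast
    have h3 := dvd_sub (h2.mul_left α) (Int.natCast_dvd_natCast.mpr h1)
    rwa [show α * geo α c + 1 - ((c : ℤ) + 1) = α * geo α c - c by ring]
  · exact dvd_sub (dvd_geo_of_dvd hQ (fun p hp1 hp2 => hp p hp1 (hp2.mul_left P)) he.right)
      (Int.natCast_dvd_natCast.mpr he.right)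

theorem dvd_pow_sub (he : IsIdempotent P Q e) (h : P.Coprime Q) (hP : P ≠ 0)
    (hp : ∀ p : ℕ, p.Prime → p ∣ P * Q → (p : ℤ) ∣ α - 1) :
    ((P * Q : ℕ) : ℤ) ∣ e * α ^ e - e * α := by
  refine mul_dvd_of_coprime h ?_ ?_
  · rcases Nat.eq_zero_or_pos e with rfl | h0
    · simp
    obtain ⟨c, rfl⟩ : ∃ c, e = c + 1 := ⟨e - 1, by omega⟩
    have h1 : P ∣ c := by
      have := he.left; push_cast at this; simpa [Int.natCast_dvd_natCast] using this
    have h2 := dvd_pow_sub_one (α := α) hP (fun p hp1 hp2 => hp p hp1 (hp2.mul_right Q)) h1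
    rw [pow_succ, ← mul_sub, ← sub_one_mul]
    exact (h2.mul_right _).mul_left _
  · exact dvd_sub ((Int.natCast_dvd_natCast.mpr he.right).mul_right _)
      ((Int.natCast_dvd_natCast.mpr he.right).mul_right _)

end IsIdempotent

namespace MacRel

variable {G : Type*} [Group G] {α : ℤ} {A B C : G} {P Q e e' : ℕ}

theorem pow_mul_pow_idempotent (h : MacRel α A B C) (hPQ : P.Coprime Q) (hP : P ≠ 0)
    (hA : A ^ (P * Q) = 1)
    (hp : ∀ p : ℕ, p.Prime → p ∣ P * Q → (p : ℤ) ∣ α - 1) (he : IsIdempotent P Q e) :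
    A ^ e * C ^ e = C ^ e * (A ^ e) ^ α := by
  have h1 := zpow_mul_pow h.left e e
  rw [zpow_natCast, zpow_congr hA (he.dvd_pow_sub hPQ hP hp), zpow_mul, zpow_natCast] at h1
  exact h1

theorem pow_mul_idempotent (h : MacRel α A B C) (hPQ : P.Coprime Q) (hP : P ≠ 0) (hQ : Q ≠ 0)
    (hA : A ^ (P * Q) = 1)
    (hp : ∀ p : ℕ, p.Prime → p ∣ P * Q → (p : ℤ) ∣ α - 1) (he : IsIdempotent P Q e) :
    A ^ e * B = B * (A ^ e * C ^ e) := by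
  rw [h.pow_mul_right, h.pow_mul_pow_idempotent hPQ hP hA hp he, ← zpow_natCast A e, ← zpow_mul,
    mul_comm α, zpow_congr hA (x := geo α e * α) (y := e * α)]
  rw [← sub_mul]
  exact (he.dvd_geo_sub hPQ hP hQ hp).mul_right α

theorem right_idempotent (h : MacRel α A B C) (hPQ : P.Coprime Q) (hP : P ≠ 0)
    (hB : B ^ (P * Q) = 1)
    (hp : ∀ p : ℕ, p.Prime → p ∣ P * Q → (p : ℤ) ∣ α - 1) (he : IsIdempotent P Q e) :
    C ^ e * B ^ e = (B ^ e) ^ α * C ^ e := by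
  have h1 := pow_mul_zpow h.right e e
  rw [zpow_natCast, zpow_congr hB (he.dvd_pow_sub hPQ hP hp), zpow_mul, zpow_natCast] at h1
  exact h1

/-- Components of coprime order of `A` and `B` commute. -/
theorem commute_pow_pow (h : MacRel α A B C) (hPQ : P.Coprime Q) (hP : P ≠ 0) (hQ : Q ≠ 0)
    (hA : A ^ (P * Q) = 1) (hB : B ^ (P * Q) = 1)
    (hp : ∀ p : ℕ, p.Prime → p ∣ P * Q → (p : ℤ) ∣ α - 1) (he : IsIdempotent P Q e)
    (he' : P ∣ e') : Commute (A ^ e) (B ^ e') := by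
  have hC := h.pow_C_eq_one (Nat.mul_ne_zero hP hQ) hA hp
  have ht : C ^ e * B = B * ((B ^ e) ^ (α - 1) * C ^ e) := by
    have h1 := conj_pow (i := e) (a := B⁻¹) (b := C)
    rw [inv_inv, mul_assoc, h.mul_right_gen, inv_mul_cancel_left, mul_pow_eq' h.right, mul_assoc,
      eq_inv_mul_iff_mul_eq] at h1
    rw [← h1, ← zpow_natCast B e, ← zpow_mul, mul_comm (α - 1),
      zpow_congr hB (x := geo α e * (α - 1)) (y := e * (α - 1))]
    rw [← sub_mul]
    exact (he.dvd_geo_sub hPQ hP hQ hp).mul_right _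
  -- The whole `B` acts on the components `A ^ e`, `B ^ e`, `C ^ e` as in the relations. After `P`
  -- steps the error terms are a `P`-th power of `C ^ e` and `B ^ e` to a multiple of `P`, both
  -- trivial.
  have h1 := mul_pow_of_act (h.right_idempotent hPQ hP hB hp he) (Commute.pow_right rfl e)
    (h.pow_mul_idempotent hPQ hP hQ hA hp he) ht P
  obtain ⟨c, hc⟩ := he.right
  have h2 : (B ^ e) ^ (-defect α P) = 1 := by
    obtain ⟨d, hd⟩ := dvd_defect hP fun p hp1 hp2 => hp p hp1 (hp2.mul_right Q)
    rw [← zpow_natCast, ← zpow_mul, zpow_congr hB (y := 0), zpow_zero]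
    exact ⟨-(c * d), by rw [hc, hd]; push_cast; ring⟩
  have h3 : (C ^ e) ^ P = 1 := by
    rw [← pow_mul, hc, show Q * c * P = P * Q * c by ring, pow_mul, hC, one_pow]
  rw [h2, h3, mul_one, mul_one] at h1
  obtain ⟨d, rfl⟩ := he'
  rw [pow_mul]
  exact Commute.pow_right h1 d

/-- The powers of `A`, `B`, `C` that are their components of order dividing `P` satisfy the same
relations. -/
theorem idempotent (h : MacRel α A B C) (hPQ : P.Coprime Q) (hP : P ≠ 0) (hQ : Q ≠ 0)
    (hA : A ^ (P * Q) = 1) (hB : B ^ (P * Q) = 1)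
    (hp : ∀ p : ℕ, p.Prime → p ∣ P * Q → (p : ℤ) ∣ α - 1) (he : IsIdempotent P Q e)
    (he' : IsIdempotent Q P e') (hee : ((P * Q : ℕ) : ℤ) ∣ ((e' + e : ℕ) : ℤ) - 1) :
    MacRel α (A ^ e) (B ^ e) (C ^ e) where
  comm := by
    have h1 := h.pow_mul_idempotent hPQ hP hQ hA hp he
    have h2 : B ^ e' * B ^ e = B := by
      have := zpow_congr hB hee
      rw [zpow_one, zpow_natCast] at this
      rw [← pow_add, this]
    have h3 := h.commute_pow_pow hPQ hP hQ hA hB hp he he'.right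
    refine mul_left_cancel (a := B ^ e') ?_
    rw [← mul_assoc, ← h3.eq, mul_assoc, h2, h1, mul_assoc (B ^ e), ← mul_assoc (B ^ e'), h2]
  left := h.pow_mul_pow_idempotent hPQ hP hA hp he
  right := h.right_idempotent hPQ hP hB hp he

end MacRel

theorem MacRel.torsion_of_mem_closure {G : Type u} [Group G] {α : ℤ} {x y z : G} {M : ℕ}
    {K : Subgroup G} (h : MacRel α x y z) (hK : K = Subgroup.closure {x, y}) (hM : M ≠ 0)
    (hx : x ^ M = 1) (hy : y ^ M = 1)
    (hp : ∀ p : ℕ, p.Prime → p ∣ M → (p : ℤ) ∣ α - 1) : ∀ g ∈ K, ∃ j : ℕ, g ^ M ^ j = 1 := by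
  intro g hg
  have hxK : x ∈ K := hK ▸ Subgroup.subset_closure (Or.inl rfl)
  have hyK : y ∈ K := hK ▸ Subgroup.subset_closure (Or.inr rfl)
  have hzK : z ∈ K := by
    rw [h.eq_comm]
    exact mul_mem (mul_mem (mul_mem (inv_mem hxK) (inv_mem hyK)) hxK) hyK
  have hrel : MacRel α (⟨x, hxK⟩ : K) ⟨y, hyK⟩ ⟨z, hzK⟩ :=
    MacRel.of_injective (f := K.subtype) K.subtype_injective h
  obtain ⟨j, hj⟩ := hrel.torsion M (closure_subtype_eq_top hK hxK hyK) hM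
    (Subtype.ext (by simpa using hx)) (Subtype.ext (by simpa using hy)) hp ⟨g, hg⟩
  exact ⟨j, by simpa using congrArg Subtype.val hj⟩

/-- The components for `ℓ ^ N` and for `Q` generate commuting torsion subgroups `H` and `H'` of
coprime exponents whose product is the whole group. An element of `J` therefore has trivial
`H'`-part, so `J ≤ H`, and maximality of `J` gives equality. -/
theorem sylow_eq_closure {G : Type u} [Group G] {α : ℤ} {A B C : G} {ℓ N Q : ℕ} [Fact ℓ.Prime]
    (h : MacRel α A B C) (hgen : Subgroup.closure {A, B} = ⊤) (hℓ : (ℓ ^ N).Coprime Q)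
    (hQℓ : ℓ.Coprime Q)
    (hQ : Q ≠ 0) (hA : A ^ (ℓ ^ N * Q) = 1) (hB : B ^ (ℓ ^ N * Q) = 1)
    (hp : ∀ p : ℕ, p.Prime → p ∣ ℓ ^ N * Q → (p : ℤ) ∣ α - 1) (J : Sylow ℓ G) :
    ∃ e : ℕ, ((ℓ ^ N : ℕ) : ℤ) ∣ e - 1 ∧ MacRel α (A ^ e) (B ^ e) (C ^ e) ∧
      (J : Subgroup G) = Subgroup.closure {A ^ e, B ^ e} := by
  set P := ℓ ^ N with hPdef
  have hP : P ≠ 0 := pow_ne_zero N (Fact.out : ℓ.Prime).ne_zero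
  obtain ⟨e, he⟩ := IsIdempotent.exists_of_coprime hℓ
  obtain ⟨e', he'⟩ := IsIdempotent.exists_of_coprime hℓ.symm
  have hA' : A ^ (Q * P) = 1 := by rwa [mul_comm]
  have hB' : B ^ (Q * P) = 1 := by rwa [mul_comm]
  have hp' : ∀ p : ℕ, p.Prime → p ∣ Q * P → (p : ℤ) ∣ α - 1 := by rwa [mul_comm]
  have hee : ((P * Q : ℕ) : ℤ) ∣ ((e' + e : ℕ) : ℤ) - 1 := by
    refine IsIdempotent.mul_dvd_of_coprime hℓ ?_ ?_
    · push_cast; rw [add_sub_assoc]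
      exact dvd_add (Int.natCast_dvd_natCast.mpr he'.right) he.left
    · push_cast; rw [add_comm, add_sub_assoc]
      exact dvd_add (Int.natCast_dvd_natCast.mpr he.right) he'.left
  have hee' : ((Q * P : ℕ) : ℤ) ∣ ((e + e' : ℕ) : ℤ) - 1 := by rw [mul_comm Q P, add_comm e e']; exact hee
  have hrel := h.idempotent hℓ hP hQ hA hB hp he he' hee
  have hrel' := h.idempotent hℓ.symm hQ hP hA' hB' hp' he' he hee'
  refine ⟨e, he.left, hrel, ?_⟩
  set H := Subgroup.closure {A ^ e, B ^ e} with hH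
  set H' := Subgroup.closure {A ^ e', B ^ e'} with hH'
  -- the two parts are generated by elements of coprime orders
  have torsH : ∀ g ∈ H, ∃ j : ℕ, g ^ P ^ j = 1 := by
    obtain ⟨c, hc⟩ := he.right
    refine hrel.torsion_of_mem_closure hH hP ?_ ?_ fun p hp1 hp2 => hp p hp1 (hp2.mul_right Q)
    · rw [← pow_mul, hc, show Q * c * P = P * Q * c by ring, pow_mul, hA, one_pow]
    · rw [← pow_mul, hc, show Q * c * P = P * Q * c by ring, pow_mul, hB, one_pow]
  have torsH' : ∀ g ∈ H', ∃ j : ℕ, g ^ Q ^ j = 1 := by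
    obtain ⟨c, hc⟩ := he'.right
    refine hrel'.torsion_of_mem_closure hH' hQ ?_ ?_ fun p hp1 hp2 => hp p hp1 (hp2.mul_left P)
    · rw [← pow_mul, hc, show P * c * Q = P * Q * c by ring, pow_mul, hA, one_pow]
    · rw [← pow_mul, hc, show P * c * Q = P * Q * c by ring, pow_mul, hB, one_pow]
  have hcomm : ∀ x ∈ H, ∀ y ∈ H', Commute x y := by
    have h1 : Commute (A ^ e) (A ^ e') := (Commute.refl A).pow_pow _ _
    have h2 : Commute (B ^ e) (B ^ e') := (Commute.refl B).pow_pow _ _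
    have h3 := h.commute_pow_pow hℓ hP hQ hA hB hp he he'.right
    have h4 := h.symm.commute_pow_pow hℓ hP hQ hB hA hp he he'.right
    have hle : H ≤ Subgroup.centralizer (H' : Set G) := by
      rw [hH', Subgroup.centralizer_closure, hH, Subgroup.closure_le]
      rintro x (rfl | rfl) <;> rw [SetLike.mem_coe, Subgroup.mem_centralizer_iff] <;>
        rintro y (rfl | rfl)
      exacts [h1.symm, h3.symm, h4.symm, h2.symm]
    exact fun x hx y hy => (Subgroup.mem_centralizer_iff.mp (hle hx) y hy).symm
  have hdecomp : ∀ g : G, ∃ x ∈ H, ∃ y ∈ H', g = x * y := by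
    intro g
    have hg : g ∈ Subgroup.closure {A, B} := hgen ▸ Subgroup.mem_top g
    have gen : ∀ {x : G}, x ^ (P * Q) = 1 → x = x ^ e * x ^ e' := fun {x} hx => by
      have := zpow_congr hx hee
      rw [zpow_one, zpow_natCast] at this
      rw [← pow_add, add_comm, this]
    induction hg using Subgroup.closure_induction with
    | mem x hx =>
      rcases hx with rfl | rfl
      · exact ⟨_, Subgroup.subset_closure (Or.inl rfl), _, Subgroup.subset_closure (Or.inl rfl),
          gen hA⟩
      · exact ⟨_, Subgroup.subset_closure (Or.inr rfl), _, Subgroup.subset_closure (Or.inr rfl),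
          gen hB⟩
    | one => exact ⟨1, one_mem _, 1, one_mem _, by simp⟩
    | mul x y _ _ hx hy =>
      obtain ⟨x1, hx1, x2, hx2, rfl⟩ := hx
      obtain ⟨y1, hy1, y2, hy2, rfl⟩ := hy
      refine ⟨x1 * y1, mul_mem hx1 hy1, x2 * y2, mul_mem hx2 hy2, ?_⟩
      rw [mul_assoc, ← mul_assoc x2, ← (hcomm y1 hy1 x2 hx2).eq]; group
    | inv x _ hx =>
      obtain ⟨x1, hx1, x2, hx2, rfl⟩ := hx
      refine ⟨x1⁻¹, inv_mem hx1, x2⁻¹, inv_mem hx2, ?_⟩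
      rw [(hcomm x1 hx1 x2 hx2).eq, mul_inv_rev]
  have hHp : IsPGroup ℓ H := by
    rintro ⟨g, hg⟩
    obtain ⟨j, hj⟩ := torsH g hg
    exact ⟨N * j, Subtype.ext (by simpa [pow_mul, hPdef] using hj)⟩
  refine (J.is_maximal' hHp ?_).symm
  intro g hg
  obtain ⟨x, hx, y, hy, rfl⟩ := hdecomp g
  obtain ⟨k, hk⟩ := J.isPGroup' ⟨_, hg⟩
  obtain ⟨j, hj⟩ := torsH x hx
  obtain ⟨i, hi⟩ := torsH' y hy
  have h1 : (x * y) ^ (ℓ ^ k * P ^ j) = 1 := by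
    rw [pow_mul, show (x * y) ^ ℓ ^ k = 1 by simpa using congrArg Subtype.val hk, one_pow]
  rw [(hcomm x hx y hy).mul_pow, mul_comm (ℓ ^ k), pow_mul, hj, one_pow, one_mul] at h1
  have h2 : (P ^ j * ℓ ^ k).Coprime (Q ^ i) := by
    refine Nat.Coprime.pow_right i (Nat.Coprime.mul_left (hℓ.pow_left j) (hQℓ.pow_left k))
  have h3 : y = 1 := by
    have := Nat.dvd_gcd (orderOf_dvd_of_pow_eq_one h1) (orderOf_dvd_of_pow_eq_one hi)
    rw [h2.gcd_eq_one] at this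
    exact orderOf_eq_one_iff.mp (Nat.dvd_one.mp this)
  rw [h3, mul_one]
  exact hx

end MacdonaldGroup

/-! ### The case `α ≡ 7 mod 9`: arithmetic, and orders in a 3-group -/

namespace MacdonaldGroup

section Arithmetic

variable {α : ℤ}

theorem prime_dvd_sub_one_of_pow (hα : (9 : ℤ) ∣ α - 7) {s : ℕ} :
    ∀ p : ℕ, p.Prime → p ∣ 3 ^ s → (p : ℤ) ∣ α - 1 := by
  intro p hp hps
  rw [(Nat.prime_dvd_prime_iff_eq hp Nat.prime_three).mp (hp.dvd_of_dvd_pow hps)]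
  push_cast; omega

theorem dvd_defect_pow (hα : (9 : ℤ) ∣ α - 7) (s : ℕ) :
    ((3 ^ (s + 1) : ℕ) : ℤ) ∣ defect α (3 ^ s) := by
  have h1 := (dvd_geo_and_wgeo (n := 3 ^ s) (by positivity) (prime_dvd_sub_one_of_pow hα)).2
  have h2 : IsCoprime ((3 ^ s : ℕ) : ℤ) 2 := by
    rw [show (2 : ℤ) = ((2 : ℕ) : ℤ) from rfl, Nat.isCoprime_iff_coprime]
    exact Nat.Coprime.pow_left s (by norm_num)
  have h3 := h2.dvd_of_dvd_mul_left h1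
  rw [defect_eq, dvd_neg, pow_succ, mul_comm (3 ^ s), Nat.cast_mul]
  exact mul_dvd_mul (by push_cast; omega) h3

/-- Cubing raises the valuation of `α ^ 3 ^ s - 1` by exactly one. The exactness, `3 ∤ w`, is what
later makes `[A, C ^ 3 ^ s]` nontrivial. -/
theorem exists_pow_eq (hα : (9 : ℤ) ∣ α - 7) (s : ℕ) :
    ∃ w : ℤ, α ^ 3 ^ s = 1 + ((3 ^ (s + 1) : ℕ) : ℤ) * w ∧ ¬ 3 ∣ w := by
  induction s with
  | zero => exact ⟨(α - 1) / 3, by norm_num; omega, by omega⟩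
  | succ s ih =>
    obtain ⟨w, hw, hw3⟩ := ih
    refine ⟨w + 3 * (3 ^ s * w ^ 2 + 3 ^ s * 3 ^ s * w ^ 3), ?_, by omega⟩
    rw [pow_succ 3 s, pow_mul, hw]; push_cast; ring

theorem geo_modEq {β m : ℤ} (h : m ∣ α - β) (n : ℕ) : m ∣ geo α n - geo β n := by
  induction n with
  | zero => simp
  | succ n ih =>
    rw [geo_succ', geo_succ', add_sub_add_comm]
    exact dvd_add ih (h.trans (sub_dvd_pow_sub_pow α β n))

/-- The defect modulo 81 depends only on `α` and `n` modulo 81, which reduces `exists_defect_eq` to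
nine residues of `α`. -/
theorem defect_modEq (hα : (9 : ℤ) ∣ α - 7) {β : ℤ} {m n : ℕ} (hr : (81 : ℤ) ∣ α - β)
    (hn : (81 : ℤ) ∣ (n : ℤ) - m) (hmn : m ≤ n) : (81 : ℤ) ∣ defect α n - defect β m := by
  obtain ⟨c, rfl⟩ : ∃ c, n = m + 81 * c := ⟨(n - m) / 81, by omega⟩
  have hβ : (9 : ℤ) ∣ β - 7 := by omega
  have hd : 3 ^ 4 ∣ 81 * c := Dvd.intro c (by norm_num)
  obtain ⟨a1, ha1⟩ := geo_modEq hr (m + 81 * c)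
  obtain ⟨a2, ha2⟩ := dvd_geo_of_dvd (α := β) (by norm_num) (prime_dvd_sub_one_of_pow hβ) hd
  obtain ⟨b1, hb1⟩ := hr.trans (sub_dvd_pow_sub_pow α β (m + 81 * c))
  obtain ⟨b2, hb2⟩ := dvd_pow_sub_one (α := β) (by norm_num) (prime_dvd_sub_one_of_pow hβ) hd
  obtain ⟨d, hd⟩ := hr
  rw [geo_add β] at ha1
  rw [pow_add β] at hb1
  push_cast at ha2 hb2
  refine ⟨d * geo β m + α * (a1 + β ^ m * a2) - (m + 81 * c) * (b1 + β ^ m * b2)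
    - c * β ^ m, ?_⟩
  simp only [defect]
  push_cast
  linear_combination α * (ha1 + β ^ m * ha2) + geo β m * hd
    - (m + 81 * c : ℤ) * (hb1 + β ^ m * hb2)

theorem exists_defect_eq (hα : (9 : ℤ) ∣ α - 7) : ∃ l : ℕ, ∀ n : ℕ, (81 : ℤ) ∣ n - α ^ l →
    ∃ u : ℤ, defect α n = 27 * u ∧ ¬ 3 ∣ u := by
  have key : ∀ t < 9, ∃ l < 3,
      (defect (7 + 9 * (t : ℕ)) ((7 + 9 * t) ^ l % 81)) % 81 = 27 ∨
      (defect (7 + 9 * (t : ℕ)) ((7 + 9 * t) ^ l % 81)) % 81 = 54 := by decide +kernel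
  obtain ⟨t, ht9, hr⟩ : ∃ t : ℕ, t < 9 ∧ (81 : ℤ) ∣ α - (7 + 9 * (t : ℕ)) :=
    ⟨((α - 7) / 9 % 9).toNat, by omega, by omega⟩
  obtain ⟨l, -, hl⟩ := key t ht9
  refine ⟨l, fun n hn => ?_⟩
  have h1 := hr.trans (sub_dvd_pow_sub_pow α (7 + 9 * (t : ℕ)) l)
  set m := (7 + 9 * t) ^ l % 81 with hm
  have h2 : (81 : ℤ) ∣ (7 + 9 * (t : ℤ)) ^ l - m := by
    have : (((7 + 9 * t) ^ l % 81 : ℕ) : ℤ) = (7 + 9 * (t : ℤ)) ^ l % 81 := by push_cast; rfl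
    rw [hm, this]
    exact (Int.mod_modEq _ _).dvd
  have h3 : (81 : ℤ) ∣ (n : ℤ) - m := by omega
  have h4 : m ≤ n := by omega
  have h5 := defect_modEq hα hr h3 h4
  set x := defect α n
  set y := defect (7 + 9 * (t : ℤ)) m
  exact ⟨x / 27, by omega, by omega⟩

theorem dvd_pow_three_sub_one (hα : (9 : ℤ) ∣ α - 7) (s : ℕ) :
    ((3 ^ (s + 1) : ℕ) : ℤ) ∣ α ^ 3 ^ s - 1 := by
  obtain ⟨w, hw, -⟩ := exists_pow_eq hα s
  exact ⟨w, by rw [hw]; ring⟩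

end Arithmetic

/-- The relations that hold for a generating pair of a `3`-group. -/
structure ThreePair {G : Type*} [Group G] (α : ℤ) (A B C : G) : Prop where
  rel : MacRel α A B C
  gen : Subgroup.closure {A, B} = ⊤
  three : IsPGroup 3 G
  mod : (9 : ℤ) ∣ α - 7
  left_order : A ^ 81 = 1
  right_order : B ^ 81 = 1
  comm_order : C ^ 27 = 1
  mul_eq : A ^ 27 * B ^ 27 = 1

theorem pow_eighty_one {G : Type*} [Group G] {x : G} {N : ℕ} {v : ℤ} (hN : x ^ 3 ^ N = 1)
    (hv : ¬ 3 ∣ v) (h : x ^ (81 * v) = 1) : x ^ 81 = 1 := by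
  rw [← orderOf_dvd_iff_pow_eq_one] at hN ⊢
  have h1 := orderOf_dvd_iff_zpow_eq_one.mpr h
  have h2 : IsCoprime (orderOf x : ℤ) v := by
    have h3 : IsCoprime (3 : ℤ) v := (Int.prime_three.coprime_iff_not_dvd).mpr hv
    exact (h3.pow_left (m := N)).of_isCoprime_of_dvd_left (by exact_mod_cast hN)
  exact_mod_cast h2.dvd_of_dvd_mul_right h1

/-- The fundamental identity with exponent `27 u`, `3 ∤ u`, bounds the orders of `A` and `B` by 81
and makes their 27th powers central and mutually inverse. Conjugating `A` by the central `B ^ 27`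
then gives `C ^ 27 = 1`. -/
theorem MacRel.threePair {G : Type*} [Group G] {α : ℤ} {A B C : G} (h : MacRel α A B C)
    (hgen : Subgroup.closure {A, B} = ⊤) (h3 : IsPGroup 3 G) (hα : (9 : ℤ) ∣ α - 7) :
    ThreePair α A B C := by
  obtain ⟨a, ha⟩ := h3 A
  obtain ⟨b, hb⟩ := h3 B
  -- The factor 81 makes a congruence modulo `M` usable modulo 81.
  set M := 81 * (3 ^ a * 3 ^ b) with hM
  have hA : A ^ M = 1 := by rw [hM, mul_comm, mul_assoc, pow_mul, ha, one_pow]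
  have hB : B ^ M = 1 := by
    rw [hM, mul_comm, mul_comm (3 ^ a), mul_assoc, pow_mul, hb, one_pow]
  obtain ⟨l, hl⟩ := exists_defect_eq hα
  obtain ⟨n, hn⟩ : ∃ n : ℕ, (M : ℤ) ∣ (n : ℤ) - α ^ l := by
    refine ⟨(α ^ l % M).toNat, ?_⟩
    rw [Int.toNat_of_nonneg (Int.emod_nonneg _ (by positivity))]
    exact (Int.mod_modEq _ _).symm.dvd
  obtain ⟨h1, h2, h4, h5, h6⟩ := h.central_of_modEq hA hB hn
  have h81 : (81 : ℤ) ∣ M := ⟨3 ^ a * 3 ^ b, by push_cast [hM]; ring⟩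
  obtain ⟨u, hu, hu3⟩ := hl n (h81.trans hn)
  obtain ⟨k, hk⟩ : ∃ k : ℤ, α - 1 = 3 * k := ⟨(α - 1) / 3, by omega⟩
  have hku : ¬ 3 ∣ k * u := fun h0 => by
    rcases Int.prime_three.dvd_or_dvd h0 with h0 | h0 <;> omega
  have e : (α - 1) * defect α n = 81 * (k * u) := by rw [hu, hk]; ring
  rw [e] at h5 h6
  have hA81 := pow_eighty_one ha hku h5
  have hB81 := pow_eighty_one hb hku h6
  -- As `u ^ 2 ≡ 1 mod 3`, raising to the power `u` turns exponent `27 u` back into 27.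
  obtain ⟨d, hd⟩ : ∃ d, u * u = 1 + 3 * d := by
    obtain ⟨v, hv⟩ : ∃ v, u = 3 * v + 1 ∨ u = 3 * v + 2 := ⟨u / 3, by omega⟩
    rcases hv with rfl | rfl
    · exact ⟨3 * v ^ 2 + 2 * v, by ring⟩
    · exact ⟨3 * v ^ 2 + 4 * v + 1, by ring⟩
  have hpow : ∀ {x : G}, x ^ 81 = 1 → x ^ 27 = (x ^ defect α n) ^ u := fun {x} hx => by
    rw [← zpow_mul, ← zpow_natCast]
    refine zpow_congr (M := 81) hx ⟨-d, ?_⟩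
    rw [hu, mul_assoc, hd]; push_cast; ring
  have hBc : Commute A (B ^ 27) := hpow hB81 ▸ h2.zpow_right u
  refine ⟨h, hgen, h3, hα, hA81, hB81, ?_, ?_⟩
  · have h7 := h.mul_pow_right 27
    rw [zpow_neg, zpow_congr (M := 81) hB81 (x := defect α 27) (y := 0)
      (by rw [sub_zero]; exact dvd_defect_pow hα 3), zpow_zero, inv_one, mul_one, ← mul_assoc,
      ← hBc.eq, left_eq_mul] at h7
    exact h7
  · rw [hpow hA81, hpow hB81, ← ((h2.zpow_left _)).mul_zpow, h4, one_zpow]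

end MacdonaldGroup

/-! ### A permutation model in which `A` has order 81 -/

namespace MacdonaldGroup
namespace Model

/-- The sum `7 + ⋯ + 7 ^ i`. -/
def phi (i : ZMod 81) : ZMod 81 := ((7 * ((7 ^ i.val - 1) / 6) : ℕ) : ZMod 81)

/-- The multiplier `7 ^ (-i)`. -/
def mult (i : ZMod 81) : ZMod 81 := ((58 ^ i.val : ℕ) : ZMod 81)

/-- Right multiplication by `A` on the cosets `⟨C⟩ B ^ x A ^ i`. -/
def actA (p : ZMod 81 × ZMod 81) : ZMod 81 × ZMod 81 := (p.1, p.2 + 1)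

/-- Right multiplication by `B` on the cosets `⟨C⟩ B ^ x A ^ i`. -/
def actB (p : ZMod 81 × ZMod 81) : ZMod 81 × ZMod 81 := ((p.1 + 1) * mult p.2, phi p.2)

/-- Right multiplication by `C` on the cosets `⟨C⟩ B ^ x A ^ i`. -/
def actC (p : ZMod 81 × ZMod 81) : ZMod 81 × ZMod 81 := (p.1 * 58, 7 * p.2)

/-- `n` steps of the action of `B` on `(x, i)`, as an affine function of `x`: the slope, the
constant term, and the new value of `i`. -/
def iter (i : ZMod 81) : ℕ → ZMod 81 × ZMod 81 × ZMod 81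
  | 0 => (1, 0, i)
  | n + 1 =>
    let s := iter i n
    (s.1 * mult s.2.2, (s.2.1 + 1) * mult s.2.2, phi s.2.2)

theorem actB_iterate (p : ZMod 81 × ZMod 81) (n : ℕ) :
    actB^[n] p = (p.1 * (iter p.2 n).1 + (iter p.2 n).2.1, (iter p.2 n).2.2) := by
  induction n with
  | zero => simp [iter]
  | succ n ih =>
    rw [Function.iterate_succ_apply', ih]
    simp only [actB, iter, Prod.mk.injEq, and_true]
    ring

/-- The formula for `actB` comes from `A ^ i B = B C ^ i A ^ (phi i)` and `B ^ (x + 1) C ^ i = C ^ i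
B ^ ((x + 1) 7 ^ (-i))`, where `58` is the inverse of `7` modulo 81. The recursions for `phi` and
`mult` are exactly what `A B = B A C` needs. -/
theorem phi_add_one : ∀ i, phi (i + 1) = 7 * (phi i + 1) := by decide +kernel

theorem mult_add_one : ∀ i, mult (i + 1) = mult i * 58 := by decide +kernel

/-- For `C B = B ^ 7 C`: the two sides differ by the same `d` in both coordinates, with `3 d = 0`,
so they agree only after `B ^ 27` and `A ^ (-27)` are identified. -/
theorem iter_seven : ∀ i, (iter i 7).1 * 58 = 58 * mult (7 * i) ∧
    (iter i 7).2.1 * 58 - mult (7 * i) = 7 * (iter i 7).2.2 - phi (7 * i) ∧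
    3 * ((iter i 7).2.1 * 58 - mult (7 * i)) = 0 := by decide +kernel

theorem iter_twentySeven : ∀ i, iter i 27 = (1, 27, i) := by decide +kernel

theorem three_mul_eq_zero : ∀ d : ZMod 81, 3 * d = 0 → d = 0 ∨ d = 27 ∨ d = 54 := by
  decide +kernel

theorem shift : ∀ i, (phi (i + 27) = phi i + 27 ∧ mult (i + 27) = mult i ∧ 27 * mult i = 27) ∧
    phi (i + 54) = phi i + 54 ∧ mult (i + 54) = mult i ∧ 54 * mult i = 54 := by decide +kernel

theorem shift_of {d : ZMod 81} (hd : 3 * d = 0) (i : ZMod 81) :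
    phi (i + d) = phi i + d ∧ mult (i + d) = mult i ∧ d * mult i = d := by
  rcases three_mul_eq_zero d hd with rfl | rfl | rfl
  · simp
  · exact (shift i).1
  · exact (shift i).2

/-- `B ^ 27` and `A ^ (-27)` are identified. -/
instance setoid : Setoid (ZMod 81 × ZMod 81) where
  r p q := ∃ d : ZMod 81, 3 * d = 0 ∧ p.1 = q.1 + d ∧ p.2 = q.2 + d
  iseqv :=
    { refl := fun p => ⟨0, by simp⟩
      symm := fun {p q} ⟨d, h0, h1, h2⟩ =>
        ⟨-d, by linear_combination -h0, by rw [h1]; ring, by rw [h2]; ring⟩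
      trans := fun {p q r} ⟨d, h0, h1, h2⟩ ⟨e, k0, k1, k2⟩ =>
        ⟨d + e, by linear_combination h0 + k0, by rw [h1, k1]; ring, by rw [h2, k2]; ring⟩ }

/-- The set of cosets of `⟨C⟩`. -/
abbrev Cosets : Type := Quotient setoid

instance : Finite Cosets := Quotient.finite _

/-- The permutation of `Cosets` induced by a map of finite order. -/
noncomputable def perm (F : ZMod 81 × ZMod 81 → ZMod 81 × ZMod 81)
    (hF : ∀ p q, p ≈ q → F p ≈ F q) (hs : ∃ n ≠ 0, F^[n] = id) : Equiv.Perm Cosets :=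
  Equiv.ofBijective (Quotient.map F hF) <| Finite.surjective_iff_bijective.mp fun p =>
    Quotient.inductionOn p fun q => by
      obtain ⟨n, hn, h⟩ := hs
      obtain ⟨m, rfl⟩ := Nat.exists_eq_succ_of_ne_zero hn
      exact ⟨⟦F^[m] q⟧, by rw [Quotient.map_mk, ← Function.iterate_succ_apply' F, h, id]⟩

theorem perm_mk {F hF hs} (p : ZMod 81 × ZMod 81) : perm F hF hs ⟦p⟧ = ⟦F p⟧ := rfl

theorem perm_pow_mk {F hF hs} (n : ℕ) (p : ZMod 81 × ZMod 81) :
    (perm F hF hs ^ n) ⟦p⟧ = ⟦F^[n] p⟧ := by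
  induction n with
  | zero => rfl
  | succ n ih => rw [pow_succ', Equiv.Perm.mul_apply, ih, perm_mk, Function.iterate_succ_apply']

theorem actA_iterate (p : ZMod 81 × ZMod 81) (n : ℕ) : actA^[n] p = (p.1, p.2 + n) := by
  induction n with
  | zero => simp
  | succ n ih => rw [Function.iterate_succ_apply', ih, actA]; push_cast; rw [add_assoc]

theorem actA_order : actA^[81] = id := by
  funext p
  rw [actA_iterate, show ((81 : ℕ) : ZMod 81) = 0 from ZMod.natCast_self 81, add_zero]; rfl

theorem actB_order : actB^[81] = id := by
  have h : ∀ p, actB^[27] p = (p.1 + 27, p.2) := fun p => by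
    rw [actB_iterate, iter_twentySeven, mul_one]
  funext p
  show actB^[27 + (27 + 27)] p = p
  rw [Function.iterate_add_apply, Function.iterate_add_apply, h, h, h]
  ext
  · show p.1 + 27 + 27 + 27 = p.1
    rw [add_assoc, add_assoc, show (27 : ZMod 81) + (27 + 27) = 0 from rfl, add_zero]
  · rfl

theorem actC_order : actC^[27] = id := by
  have h : ∀ (p : ZMod 81 × ZMod 81) (n : ℕ), actC^[n] p = (p.1 * 58 ^ n, 7 ^ n * p.2) := by
    intro p n
    induction n with
    | zero => simp
    | succ n ih =>
      rw [Function.iterate_succ_apply', ih, actC]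
      ext <;> simp only <;> ring
  funext p
  rw [h, show (58 : ZMod 81) ^ 27 = 1 by decide +kernel,
    show (7 : ZMod 81) ^ 27 = 1 by decide +kernel, mul_one, one_mul]; rfl

/-- The action of `A`. -/
noncomputable def permA : Equiv.Perm Cosets :=
  perm actA (fun p q ⟨d, h0, h1, h2⟩ => ⟨d, h0, h1, by simp only [actA, h2]; ring⟩)
    ⟨81, by norm_num, actA_order⟩

/-- The action of `B`. -/
noncomputable def permB : Equiv.Perm Cosets :=
  perm actB (fun p q ⟨d, h0, h1, h2⟩ => by
    obtain ⟨k1, k2, k3⟩ := shift_of h0 q.2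
    refine ⟨d, h0, ?_, ?_⟩
    · simp only [actB, h1, h2, k2]; linear_combination k3
    · simp only [actB, h2, k1]) ⟨81, by norm_num, actB_order⟩

/-- The action of `C`. -/
noncomputable def permC : Equiv.Perm Cosets :=
  perm actC (fun p q ⟨d, h0, h1, h2⟩ => by
    refine ⟨d, h0, ?_, ?_⟩
    · simp only [actC, h1]; linear_combination 19 * h0
    · simp only [actC, h2]; linear_combination 2 * h0) ⟨27, by norm_num, actC_order⟩

/-- Right multiplications compose in the reverse order, hence the inverses. -/
theorem macRel_seven : MacRel 7 permA⁻¹ permB⁻¹ permC⁻¹ where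
  comm := by
    rw [← mul_inv_rev, ← mul_inv_rev, ← mul_inv_rev, inv_inj]
    ext p
    induction p using Quotient.inductionOn with | _ p => ?_
    simp only [Equiv.Perm.mul_apply, permA, permB, permC, perm_mk]
    congr 1
    simp only [actA, actB, actC, phi_add_one, mult_add_one, Prod.mk.injEq, and_true]
    ring
  left := by
    rw [inv_zpow, ← mul_inv_rev, ← mul_inv_rev, inv_inj, ← Nat.cast_ofNat, zpow_natCast]
    ext p
    induction p using Quotient.inductionOn with | _ p => ?_
    simp only [Equiv.Perm.mul_apply, permA, permC, perm_mk, perm_pow_mk, actA_iterate]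
    congr 1
    simp only [actA, actC, Prod.mk.injEq, true_and]
    push_cast; ring
  right := by
    rw [inv_zpow, ← mul_inv_rev, ← mul_inv_rev, inv_inj, ← Nat.cast_ofNat, zpow_natCast]
    ext p
    induction p using Quotient.inductionOn with | _ p => ?_
    simp only [Equiv.Perm.mul_apply, permB, permC, perm_mk, perm_pow_mk, actB_iterate]
    obtain ⟨h1, h2, h3⟩ := iter_seven p.2
    refine Eq.symm (Quotient.sound ⟨(iter p.2 7).2.1 * 58 - mult (7 * p.2), h3, ?_, ?_⟩)
    · simp only [actB, actC]; linear_combination p.1 * h1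
    · simp only [actB, actC, h2]; ring

theorem permA_pow_order : permA⁻¹ ^ 81 = 1 := by
  rw [inv_pow, inv_eq_one]
  ext p
  induction p using Quotient.inductionOn with | _ p => ?_
  rw [permA, perm_pow_mk, actA_order]; rfl

theorem permB_pow_order : permB⁻¹ ^ 81 = 1 := by
  rw [inv_pow, inv_eq_one]
  ext p
  induction p using Quotient.inductionOn with | _ p => ?_
  rw [permB, perm_pow_mk, actB_order]; rfl

/-- The identification shifts both coordinates by the same amount, so `(0, 27)` and `(0, 0)` remain
distinct. -/
theorem permA_pow_ne : permA⁻¹ ^ 27 ≠ 1 := by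
  rw [inv_pow, Ne, inv_eq_one]
  intro h
  have h1 : (permA ^ 27) ⟦(0, 0)⟧ = ⟦(0, 0)⟧ := by rw [h]; rfl
  rw [permA, perm_pow_mk, actA_iterate] at h1
  obtain ⟨d, -, h2, h3⟩ := Quotient.exact h1
  have h4 : d = 0 := by simpa using h2.symm
  rw [h4] at h3
  exact absurd h3 (by decide +kernel)

end Model

/-- Passing from the pair `A, B` to `A ^ m, B` replaces `α` by `α ^ m`. -/
theorem MacRel.pow_left {G : Type*} [Group G] {α : ℤ} {A B C : G} {M : ℕ} (h : MacRel α A B C)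
    (hA : A ^ M = 1) (hB : B ^ M = 1) {l m : ℕ} (hm : (M : ℤ) ∣ (m : ℤ) - α ^ l) :
    MacRel (α ^ m) (A ^ m) B (C ^ m * A ^ defect α m) := by
  obtain ⟨hc, -⟩ := h.central_of_modEq hA hB hm
  have h1 := h.comm_pow_pow (i := 0) (n := 1) (m := m) (by simp) (by simp)
  simp only [pow_one, zero_add, one_mul, pow_zero, inv_one, mul_one] at h1
  refine ⟨h1, ?_, ?_⟩
  · have h2 := zpow_mul_pow h.left m m
    rw [zpow_natCast] at h2
    rw [← mul_assoc, h2, mul_assoc, mul_assoc, ← zpow_natCast A m, ← zpow_mul, ← zpow_add,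
      ← zpow_add, add_comm]
  · have h2 := pow_mul_zpow h.right 1 m
    rw [zpow_one, one_mul] at h2
    rw [mul_assoc, ← hc.eq, ← mul_assoc, h2, mul_assoc]

/-- For every `α ≡ 7 mod 9` there is a group in which the relations of `G(α)` hold and in which
`A` has order `81`. -/
theorem exists_model {α : ℤ} (hα : (9 : ℤ) ∣ α - 7) : ∃ (Γ : Type) (_ : Group Γ) (x y z : Γ),
    MacRel α x y z ∧ x ^ 81 = 1 ∧ x ^ 27 ≠ 1 := by
  -- The residues `7 mod 9` modulo 81 are the `7 ^ m` with `m ≡ 1 mod 3`, and every such `m` is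
  -- itself a power of 7 modulo 81, as `MacRel.pow_left` requires.
  obtain ⟨m, l, hm, hml, h3⟩ : ∃ m l : ℕ, (81 : ℤ) ∣ 7 ^ m - α ∧ (81 : ℤ) ∣ (m : ℤ) - 7 ^ l ∧
      ¬ 3 ∣ m := by
    obtain ⟨r, hr, hr9⟩ : ∃ r : ℕ, (81 : ℤ) ∣ α - (7 + 9 * r) ∧ r < 9 :=
      ⟨((α - 7) / 9 % 9).toNat, by omega, by omega⟩
    have key : ∀ r : ℕ, r < 9 → ∃ m < 27, ∃ l < 27, (81 : ℤ) ∣ (7 : ℤ) ^ (m : ℕ) - (7 + 9 * (r : ℤ)) ∧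
      (81 : ℤ) ∣ (m : ℤ) - 7 ^ (l : ℕ) ∧ ¬ 3 ∣ m := by decide +kernel
    obtain ⟨m, -, l, -, h1, h2, h4⟩ := key r hr9
    exact ⟨m, l, by have := dvd_sub h1 hr; simpa using this, h2, h4⟩
  have h := Model.macRel_seven.pow_left (M := 81) Model.permA_pow_order Model.permB_pow_order
    (l := l) (m := m) hml
  have hx : (Model.permA⁻¹ ^ m) ^ 81 = 1 := by
    rw [← pow_mul, mul_comm, pow_mul, Model.permA_pow_order, one_pow]
  refine ⟨Equiv.Perm Model.Cosets, inferInstance, _, _, _,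
    h.congr_exponent (zpow_congr (M := 81) hx hm) (zpow_congr (M := 81) Model.permB_pow_order hm),
    hx, ?_⟩
  intro h0
  rw [← pow_mul, mul_comm] at h0
  have h4 : orderOf Model.permA⁻¹ = 3 ^ (3 + 1) :=
    orderOf_eq_prime_pow Model.permA_pow_ne Model.permA_pow_order
  have h5 := orderOf_dvd_of_pow_eq_one h0
  rw [h4] at h5
  omega

end MacdonaldGroup

/-! ### Groups of class two: normal forms and cubes -/

namespace MacdonaldGroup

section Class2

variable {Q : Type*} [Group Q] {x y c : Q} {k : ℤ}

theorem zpow_mul_zpow_class_two (hx : Commute x c) (hy : Commute y c) (h : x * y = y * x * c ^ k)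
    (i j : ℤ) : x ^ i * y ^ j = y ^ j * x ^ i * c ^ (k * (i * j)) := by
  have h1 : ∀ i : ℤ, x ^ i * y = y * (x ^ i * c ^ (k * i)) := fun i => by
    have h2 := conj_zpow (i := i) (a := y⁻¹) (b := x)
    rw [inv_inv, mul_assoc, h, ← mul_assoc, inv_mul_cancel_left, (hx.zpow_right k).mul_zpow,
      ← zpow_mul, mul_assoc, eq_inv_mul_iff_mul_eq] at h2
    exact h2.symm
  have h3 : x ^ (-i) * y * x ^ i = y * c ^ (-(k * i)) := by
    rw [h1, mul_assoc, mul_assoc, ((hx.zpow_zpow i (k * -i))).symm.eq, ← mul_assoc (x ^ (-i)),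
      ← zpow_add, neg_add_cancel, zpow_zero, one_mul]
    congr 2; ring
  have h4 := conj_zpow (i := j) (a := x ^ (-i)) (b := y)
  rw [← zpow_neg, neg_neg, h3, (hy.zpow_right _).mul_zpow, ← zpow_mul] at h4
  have h5 : x ^ i * y ^ j = x ^ i * (y ^ j * c ^ (-(k * i) * j)) * c ^ (k * (i * j)) := by
    rw [mul_assoc, mul_assoc, ← zpow_add, show -(k * i) * j + k * (i * j) = 0 by ring, zpow_zero,
      mul_one]
  rw [h5, h4]
  congr 1
  rw [zpow_neg]; group

theorem mul_normal_form (hx : Commute x c) (hy : Commute y c) (h : x * y = y * x * c ^ k)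
    (i j l i' j' l' : ℤ) : y ^ j * x ^ i * c ^ l * (y ^ j' * x ^ i' * c ^ l') =
      y ^ (j + j') * x ^ (i + i') * c ^ (l + l' + k * (i * j')) := by
  have h1 : Commute (c ^ l) (y ^ j' * x ^ i') :=
    ((hy.symm.zpow_zpow _ _)).mul_right (hx.symm.zpow_zpow _ _)
  have h2 : Commute (c ^ (k * (i * j'))) (x ^ i') := hx.symm.zpow_zpow _ _
  calc _ = y ^ j * x ^ i * (c ^ l * (y ^ j' * x ^ i')) * c ^ l' := by group
    _ = y ^ j * (x ^ i * y ^ j') * x ^ i' * c ^ l * c ^ l' := by rw [h1.eq]; group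
    _ = y ^ j * y ^ j' * x ^ i * (c ^ (k * (i * j')) * x ^ i') * c ^ l * c ^ l' := by
      rw [zpow_mul_zpow_class_two hx hy h]; group
    _ = y ^ j * y ^ j' * (x ^ i * x ^ i') * (c ^ (k * (i * j')) * c ^ l * c ^ l') := by
      rw [h2.eq]; group
    _ = _ := by
      simp only [← zpow_add]
      congr 2; ring

theorem exists_normal_form (hx : Commute x c) (hy : Commute y c) (h : x * y = y * x * c ^ k)
    {g : Q} (hg : g ∈ Subgroup.closure {x, y, c}) : ∃ i j l : ℤ, g = y ^ j * x ^ i * c ^ l := by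
  induction hg using Subgroup.closure_induction with
  | mem g hg =>
    rcases hg with rfl | rfl | rfl
    · exact ⟨1, 0, 0, by simp⟩
    · exact ⟨0, 1, 0, by simp⟩
    · exact ⟨0, 0, 1, by simp⟩
  | one => exact ⟨0, 0, 0, by simp⟩
  | mul g g' _ _ hg hg' =>
    obtain ⟨i, j, l, rfl⟩ := hg
    obtain ⟨i', j', l', rfl⟩ := hg'
    exact ⟨_, _, _, mul_normal_form hx hy h _ _ _ _ _ _⟩
  | inv g _ hg =>
    obtain ⟨i, j, l, rfl⟩ := hg
    refine ⟨-i, -j, -l + k * (i * j), ?_⟩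
    rw [inv_eq_iff_mul_eq_one, mul_normal_form hx hy h]
    simp

theorem dvd_of_zpow_eq_one {g : Q} (hg : g ^ 3 = 1) (hg1 : g ≠ 1) {i : ℤ} (hi : g ^ i = 1) :
    3 ∣ i := by
  have h1 : orderOf g = 3 := orderOf_eq_prime hg hg1
  simpa [h1] using orderOf_dvd_iff_zpow_eq_one.mpr hi

/-- In class two `(v u) ^ 3 = v ^ 3 u ^ 3 [u, v] ^ 3`, the binomial coefficient `3` choose `2` being
divisible by 3. -/
theorem cube_eq_one_class_two (hx : Commute x c) (hy : Commute y c) (h : x * y = y * x * c ^ k)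
    (hx3 : x ^ 3 = 1) (hy3 : y ^ 3 = 1) (hc3 : c ^ 3 = 1) {g : Q}
    (hg : g ∈ Subgroup.closure {x, y, c}) : g ^ 3 = 1 := by
  obtain ⟨i, j, l, rfl⟩ := exists_normal_form hx hy h hg
  have h1 : Commute (y ^ j * x ^ i) (c ^ l) := (hy.zpow_zpow _ _).mul_left (hx.zpow_zpow _ _)
  have hz : ∀ {z : Q}, z ^ 3 = 1 → ∀ n : ℤ, (z ^ n) ^ 3 = 1 := fun {z} hz n => by
    rw [← zpow_natCast, zpow_comm, zpow_natCast, hz, one_zpow]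
  rw [h1.mul_pow, hz hc3, mul_one]
  have h2 := zpow_mul_zpow_class_two hx hy h i j
  have hux := hz hx3 i
  have huy := hz hy3 j
  have hud := hz hc3 (k * (i * j))
  have hcx : Commute (x ^ i) (c ^ (k * (i * j))) := hx.zpow_zpow _ _
  have hcy : Commute (y ^ j) (c ^ (k * (i * j))) := hy.zpow_zpow _ _
  set u := x ^ i
  set v := y ^ j
  set d := c ^ (k * (i * j))
  calc (v * u) ^ 3 = v * (u * v) * (u * v) * u := by simp only [pow_succ, pow_zero, one_mul]; group
    _ = v * v * u * (d * v) * (u * d) * u := by rw [h2]; group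
    _ = v * v * (u * v) * d * d * u * u := by rw [← hcy.eq, hcx.eq]; group
    _ = v * v * v * u * (d ^ 3 * u) * u := by
      rw [h2]; simp only [pow_succ, pow_zero, one_mul, mul_assoc]
    _ = v ^ 3 * u ^ 3 := by rw [hud]; simp only [pow_succ, pow_zero, one_mul, mul_assoc]
    _ = 1 := by rw [hux, huy, one_mul]

end Class2
end MacdonaldGroup

/-! ### The normal subgroups of the chain -/

namespace MacdonaldGroup

variable {G : Type*} [Group G]

/-- In a torsion group an inverse is a positive power, so conjugation by `A` and `B` alone suffices.
-/
theorem normal_of_conj_mem {A B : G} (hgen : Subgroup.closure {A, B} = ⊤)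
    (hfin : ∀ g : G, ∃ n ≠ 0, g ^ n = 1) {S : Set G}
    (hA : ∀ s ∈ S, A⁻¹ * s * A ∈ Subgroup.closure S)
    (hB : ∀ s ∈ S, B⁻¹ * s * B ∈ Subgroup.closure S) : (Subgroup.closure S).Normal := by
  have lift : ∀ {g : G}, (∀ s ∈ S, g⁻¹ * s * g ∈ Subgroup.closure S) →
      ∀ k ∈ Subgroup.closure S, g⁻¹ * k * g ∈ Subgroup.closure S := fun {g} h k hk => by
    induction hk using Subgroup.closure_induction with
    | mem k hk => exact h k hk
    | one => simp
    | mul k k' _ _ hk hk' =>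
      have := mul_mem hk hk'
      rwa [show g⁻¹ * k * g * (g⁻¹ * k' * g) = g⁻¹ * (k * k') * g by group] at this
    | inv k _ hk =>
      have := inv_mem hk
      rwa [show (g⁻¹ * k * g)⁻¹ = g⁻¹ * k⁻¹ * g by group] at this
  have hall : ∀ g : G, ∀ k ∈ Subgroup.closure S, g⁻¹ * k * g ∈ Subgroup.closure S := by
    intro g
    have hg : g ∈ Subgroup.closure {A, B} := hgen ▸ Subgroup.mem_top g
    induction hg using Subgroup.closure_induction with
    | mem g hg =>
      rcases hg with rfl | rfl
      exacts [lift hA, lift hB]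
    | one => simp
    | mul g g' _ _ hg hg' =>
      intro k hk
      rw [show (g * g')⁻¹ * k * (g * g') = g'⁻¹ * (g⁻¹ * k * g) * g' by group]
      exact hg' _ (hg k hk)
    | inv g _ hg =>
      intro k hk
      obtain ⟨n, hn, hgn⟩ := hfin g
      have hpow : ∀ m : ℕ, (g ^ m)⁻¹ * k * g ^ m ∈ Subgroup.closure S := fun m => by
        induction m with
        | zero => simpa using hk
        | succ m ih =>
          have := hg _ ih
          rwa [show g⁻¹ * ((g ^ m)⁻¹ * k * g ^ m) * g = (g ^ (m + 1))⁻¹ * k * g ^ (m + 1) by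
            rw [pow_succ]; group] at this
      obtain ⟨m, rfl⟩ := Nat.exists_eq_succ_of_ne_zero hn
      have h1 : g⁻¹ = g ^ m := by
        rw [inv_eq_iff_mul_eq_one, ← pow_succ']; exact hgn
      rw [h1]; exact hpow m
  refine ⟨fun k hk g => ?_⟩
  have := hall g⁻¹ k hk
  rwa [inv_inv] at this

/-- `x` and `y` commute modulo `K`. -/
def CommuteMod (K : Subgroup G) (x y : G) : Prop := (x * y)⁻¹ * (y * x) ∈ K

theorem commuteMod_iff {K : Subgroup G} [K.Normal] {x y : G} :
    CommuteMod K x y ↔ Commute (QuotientGroup.mk' K x) (QuotientGroup.mk' K y) := by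
  rw [CommuteMod, ← QuotientGroup.eq]; exact Iff.rfl

theorem CommuteMod.mono {K L : Subgroup G} (h : K ≤ L) {x y : G} (hx : CommuteMod K x y) :
    CommuteMod L x y := h hx

/-- Centrality modulo the previous term need only be tested on the two generators. -/
theorem mem_upperCentralSeries_succ {K : Subgroup G} {n : ℕ} {A B : G}
    (hgen : Subgroup.closure {A, B} = ⊤) (hK : Subgroup.upperCentralSeries G n = K) {g : G} :
    g ∈ Subgroup.upperCentralSeries G (n + 1) ↔ CommuteMod K A g ∧ CommuteMod K B g := by
  subst hK
  set K := Subgroup.upperCentralSeries G n with hK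
  have hc : ∀ y : G, g * y * g⁻¹ * y⁻¹ ∈ K ↔
      Commute (QuotientGroup.mk' K y) (QuotientGroup.mk' K g) := by
    intro y
    rw [show g * y * g⁻¹ * y⁻¹ = (g * y) * (y * g)⁻¹ by group, ← QuotientGroup.eq_one_iff,
      QuotientGroup.mk_mul, QuotientGroup.mk_inv, mul_inv_eq_one]
    exact eq_comm
  have h1 : g ∈ Subgroup.upperCentralSeries G (n + 1) ↔ ∀ y : G, g * y * g⁻¹ * y⁻¹ ∈ K := Iff.rfl
  rw [h1, commuteMod_iff, commuteMod_iff]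
  exact ⟨fun h => ⟨(hc A).mp (h A), (hc B).mp (h B)⟩, fun h y => (hc y).mpr <|
    commute_of_closure_eq_top
      (closure_map_eq_top hgen (QuotientGroup.mk'_surjective _)) h.1 h.2 _⟩

theorem closure_swap_inv (x y z : G) :
    Subgroup.closure {y, x, z⁻¹} = Subgroup.closure {x, y, z} := by
  have hle : ∀ x y z : G, Subgroup.closure {y, x, z⁻¹} ≤ Subgroup.closure {x, y, z} := by
    intro x y z
    rw [Subgroup.closure_le]
    rintro g (rfl | rfl | rfl)
    · exact Subgroup.subset_closure (by simp)
    · exact Subgroup.subset_closure (by simp)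
    · exact inv_mem (Subgroup.subset_closure (by simp))
  refine le_antisymm (hle x y z) ?_
  have := hle y x z⁻¹
  rwa [inv_inv] at this

/-- The subgroup generated by `A ^ 3 ^ s`, `B ^ 3 ^ s` and `C ^ 3 ^ s`. -/
def powSub (A B C : G) (s : ℕ) : Subgroup G :=
  Subgroup.closure {A ^ 3 ^ s, B ^ 3 ^ s, C ^ 3 ^ s}

/-- The subgroup generated by `A ^ 3 ^ (s + 1)`, `B ^ 3 ^ (s + 1)` and `C ^ 3 ^ s`. -/
def midSub (A B C : G) (s : ℕ) : Subgroup G :=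
  Subgroup.closure {A ^ 3 ^ (s + 1), B ^ 3 ^ (s + 1), C ^ 3 ^ s}

section Gens

variable {A B C : G} {s : ℕ}

theorem left_mem_powSub : A ^ 3 ^ s ∈ powSub A B C s := Subgroup.subset_closure (by simp)
theorem right_mem_powSub : B ^ 3 ^ s ∈ powSub A B C s := Subgroup.subset_closure (by simp)
theorem comm_mem_powSub : C ^ 3 ^ s ∈ powSub A B C s := Subgroup.subset_closure (by simp)
theorem left_mem_midSub : A ^ 3 ^ (s + 1) ∈ midSub A B C s := Subgroup.subset_closure (by simp)
theorem right_mem_midSub : B ^ 3 ^ (s + 1) ∈ midSub A B C s := Subgroup.subset_closure (by simp)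
theorem comm_mem_midSub : C ^ 3 ^ s ∈ midSub A B C s := Subgroup.subset_closure (by simp)

theorem powSub_symm : powSub B A C⁻¹ s = powSub A B C s := by
  rw [powSub, inv_pow, closure_swap_inv, powSub]

theorem midSub_symm : midSub B A C⁻¹ s = midSub A B C s := by
  rw [midSub, inv_pow, closure_swap_inv, midSub]

theorem midSub_le : midSub A B C s ≤ powSub A B C s := by
  rw [midSub, Subgroup.closure_le]
  rintro x (rfl | rfl | rfl)
  · rw [pow_succ, pow_mul]; exact pow_mem left_mem_powSub 3
  · rw [pow_succ, pow_mul]; exact pow_mem right_mem_powSub 3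
  · exact comm_mem_powSub

theorem powSub_succ_le : powSub A B C (s + 1) ≤ midSub A B C s := by
  rw [powSub, Subgroup.closure_le]
  rintro x (rfl | rfl | rfl)
  · exact left_mem_midSub
  · exact right_mem_midSub
  · rw [pow_succ, pow_mul]; exact pow_mem comm_mem_midSub 3

end Gens

namespace ThreePair

variable {α : ℤ} {A B C : G}

theorem exists_pow (h : ThreePair α A B C) (g : G) : ∃ n ≠ 0, g ^ n = 1 := by
  obtain ⟨k, hk⟩ := h.three g
  exact ⟨3 ^ k, by positivity, hk⟩

theorem symm (h : ThreePair α A B C) : ThreePair α B A C⁻¹ where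
  rel := h.rel.symm
  gen := by rw [Set.pair_comm]; exact h.gen
  three := h.three
  mod := h.mod
  left_order := h.right_order
  right_order := h.left_order
  comm_order := by rw [inv_pow, h.comm_order, inv_one]
  mul_eq := mul_eq_one_comm.mp h.mul_eq

theorem dvd_pow_sub_one (h : ThreePair α A B C) (s : ℕ) :
    ((3 ^ (s + 1) : ℕ) : ℤ) ∣ α ^ 3 ^ s - 1 :=
  dvd_pow_three_sub_one h.mod s

theorem zpow_mem_of_dvd {K : Subgroup G} {g : G} {n : ℕ} (hg : g ^ n ∈ K) {x : ℤ}
    (hx : (n : ℤ) ∣ x) : g ^ x ∈ K := by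
  obtain ⟨c, rfl⟩ := hx
  rw [zpow_mul, zpow_natCast]; exact zpow_mem hg c

theorem conj_comm_pow (h : ThreePair α A B C) (n : ℕ) :
    A⁻¹ * C ^ n * A = C ^ n * A ^ (-(α ^ n - 1)) := by
  have h1 := MacRel.zpow_mul_pow h.rel.left 1 n
  rw [zpow_one, one_mul] at h1
  have h2 : A⁻¹ * C ^ n = C ^ n * A ^ (-α ^ n) := by
    rw [inv_mul_eq_iff_eq_mul, ← mul_assoc, h1, mul_assoc, ← zpow_add]; simp
  rw [h2, mul_assoc, ← zpow_add_one]; congr 2; ring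

theorem conj_left_pow (h : ThreePair α A B C) (n : ℕ) :
    B⁻¹ * A ^ n * B = C ^ n * A ^ (α * geo α n) := by
  rw [mul_assoc, h.rel.pow_mul_right, inv_mul_cancel_left]

theorem conj_mem_powSub (h : ThreePair α A B C) (s : ℕ) :
    ∀ x ∈ ({A ^ 3 ^ s, B ^ 3 ^ s, C ^ 3 ^ s} : Set G), B⁻¹ * x * B ∈ powSub A B C s := by
  rintro x (rfl | rfl | rfl)
  · rw [h.conj_left_pow]
    exact mul_mem comm_mem_powSub (zpow_mem_of_dvd left_mem_powSub
      ((dvd_geo (by positivity) (prime_dvd_sub_one_of_pow h.mod)).mul_left _))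
  · rw [mul_assoc, ← pow_succ, pow_succ', inv_mul_cancel_left]; exact right_mem_powSub
  -- The swapped pair has `C⁻¹` as its commutator; inverting the formula returns to `C`.
  · have h1 := h.symm.conj_comm_pow (3 ^ s)
    rw [← inv_inj, inv_pow, mul_inv_rev, mul_inv_rev, inv_inv, inv_inv, mul_inv_rev, inv_inv,
      ← mul_assoc, ← zpow_neg, neg_neg] at h1
    rw [h1]
    exact mul_mem (zpow_mem_of_dvd right_mem_powSub ((Int.natCast_dvd_natCast.mpr
      (pow_dvd_pow 3 (Nat.le_succ s))).trans (h.dvd_pow_sub_one s))) comm_mem_powSub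

theorem conj_mem_midSub (h : ThreePair α A B C) (s : ℕ) :
    ∀ x ∈ ({A ^ 3 ^ (s + 1), B ^ 3 ^ (s + 1), C ^ 3 ^ s} : Set G),
      B⁻¹ * x * B ∈ midSub A B C s := by
  rintro x (rfl | rfl | rfl)
  · rw [h.conj_left_pow]
    exact mul_mem (powSub_succ_le comm_mem_powSub) (zpow_mem_of_dvd left_mem_midSub
      ((dvd_geo (by positivity) (prime_dvd_sub_one_of_pow h.mod)).mul_left _))
  · rw [mul_assoc, ← pow_succ, pow_succ', inv_mul_cancel_left]; exact right_mem_midSub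
  · have h1 := h.symm.conj_comm_pow (3 ^ s)
    rw [← inv_inj, inv_pow, mul_inv_rev, mul_inv_rev, inv_inv, inv_inv, mul_inv_rev, inv_inv,
      ← mul_assoc, ← zpow_neg, neg_neg] at h1
    rw [h1]
    exact mul_mem (zpow_mem_of_dvd right_mem_midSub (h.dvd_pow_sub_one s)) comm_mem_midSub

theorem normal_powSub (h : ThreePair α A B C) (s : ℕ) : (powSub A B C s).Normal := by
  refine normal_of_conj_mem h.gen h.exists_pow ?_ (h.conj_mem_powSub s)
  have h1 := h.symm.conj_mem_powSub s
  rw [powSub_symm, inv_pow] at h1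
  rintro x (rfl | rfl | rfl)
  · exact h1 _ (by simp)
  · exact h1 _ (by simp)
  · have := inv_mem (h1 _ (Or.inr (Or.inr rfl)))
    rwa [show (A⁻¹ * (C ^ 3 ^ s)⁻¹ * A)⁻¹ = A⁻¹ * C ^ 3 ^ s * A by group] at this

theorem normal_midSub (h : ThreePair α A B C) (s : ℕ) : (midSub A B C s).Normal := by
  refine normal_of_conj_mem h.gen h.exists_pow ?_ (h.conj_mem_midSub s)
  have h1 := h.symm.conj_mem_midSub s
  rw [midSub_symm, inv_pow] at h1
  rintro x (rfl | rfl | rfl)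
  · exact h1 _ (by simp)
  · exact h1 _ (by simp)
  · have := inv_mem (h1 _ (Or.inr (Or.inr rfl)))
    rwa [show (A⁻¹ * (C ^ 3 ^ s)⁻¹ * A)⁻¹ = A⁻¹ * C ^ 3 ^ s * A by group] at this

end ThreePair
end MacdonaldGroup

/-! ### Commutators between consecutive terms of the chain -/

namespace MacdonaldGroup
namespace MacRel

section Level

variable {Q : Type*} [Group Q] {α : ℤ} {a b c : Q} {s : ℕ}

theorem level_commute_left (h : MacRel α a b c) (hα : (9 : ℤ) ∣ α - 7)
    (ha : a ^ 3 ^ (s + 1) = 1) : Commute a (c ^ 3 ^ s) :=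
  h.commute_pow_C ha (dvd_pow_three_sub_one hα s)

theorem level_commute_right (h : MacRel α a b c) (hα : (9 : ℤ) ∣ α - 7)
    (hb : b ^ 3 ^ (s + 1) = 1) : Commute b (c ^ 3 ^ s) := by
  simpa using h.symm.level_commute_left hα hb

/-- The error in `[a ^ 3 ^ s, b] = c ^ 3 ^ s` is a power of `a` whose exponent, the defect of `3 ^
s`, is divisible by `3 ^ (s + 1)`. -/
theorem level_left (h : MacRel α a b c) (hα : (9 : ℤ) ∣ α - 7) (ha : a ^ 3 ^ (s + 1) = 1) :
    a ^ 3 ^ s * b = b * a ^ 3 ^ s * c ^ 3 ^ s := by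
  have h1 : (((3 ^ (s + 1) : ℕ)) : ℤ) ∣ α * geo α (3 ^ s) - (3 ^ s : ℕ) := by
    have h2 := dvd_add (dvd_defect_pow hα s)
      ((dvd_pow_three_sub_one hα s).mul_left ((3 ^ s : ℕ) : ℤ))
    rwa [defect, show α * geo α (3 ^ s) - ((3 ^ s : ℕ) : ℤ) * α ^ 3 ^ s +
      ((3 ^ s : ℕ) : ℤ) * (α ^ 3 ^ s - 1) = α * geo α (3 ^ s) - (3 ^ s : ℕ) by ring] at h2
  rw [h.pow_mul_right, zpow_congr ha h1, zpow_natCast,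
    ((h.level_commute_left hα ha).pow_left _).symm.eq, mul_assoc]

theorem level_right (h : MacRel α a b c) (hα : (9 : ℤ) ∣ α - 7) (hb : b ^ 3 ^ (s + 1) = 1) :
    b ^ 3 ^ s * a = a * b ^ 3 ^ s * (c ^ 3 ^ s)⁻¹ := by
  simpa using h.symm.level_left hα hb

theorem level_pow (h : MacRel α a b c) (hα : (9 : ℤ) ∣ α - 7) (ha : a ^ 3 ^ (s + 1) = 1)
    (hb : b ^ 3 ^ (s + 1) = 1) :
    a ^ 3 ^ s * b ^ 3 ^ s = b ^ 3 ^ s * a ^ 3 ^ s * (c ^ 3 ^ s) ^ ((3 ^ s : ℕ) : ℤ) := by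
  have h1 := zpow_mul_zpow_class_two (k := 1) ((h.level_commute_left hα ha).pow_left (3 ^ s))
    (h.level_commute_right hα hb) (by rw [zpow_one]; exact h.level_left hα ha) 1 (3 ^ s : ℕ)
  rwa [zpow_one, zpow_natCast, one_mul, one_mul] at h1

/-- The normal form of the elements that are central modulo the next term. -/
theorem level_dvd (h : MacRel α a b c) (hα : (9 : ℤ) ∣ α - 7) (ha : a ^ 3 ^ (s + 1) = 1)
    (hb : b ^ 3 ^ (s + 1) = 1) (hc : c ^ 3 ^ (s + 1) = 1) (hc1 : c ^ 3 ^ s ≠ 1) {i j l : ℤ}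
    (hga : Commute a ((b ^ 3 ^ s) ^ j * (a ^ 3 ^ s) ^ i * (c ^ 3 ^ s) ^ l))
    (hgb : Commute b ((b ^ 3 ^ s) ^ j * (a ^ 3 ^ s) ^ i * (c ^ 3 ^ s) ^ l)) :
    3 ∣ i ∧ 3 ∣ j := by
  have hca := h.level_commute_left hα ha
  have hcb := h.level_commute_right hα hb
  have hc3 : (c ^ 3 ^ s) ^ 3 = 1 := by rw [← pow_mul, ← pow_succ, hc]
  have h1 : Commute b ((a ^ 3 ^ s) ^ i) := by
    have h2 := ((Commute.refl b).pow_right (3 ^ s)).zpow_right (-j)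
    have h3 := (h2.mul_right hgb).mul_right (hcb.zpow_right (-l))
    rwa [show ((b ^ 3 ^ s) ^ (-j) * ((b ^ 3 ^ s) ^ j * (a ^ 3 ^ s) ^ i * (c ^ 3 ^ s) ^ l) *
      (c ^ 3 ^ s) ^ (-l)) = (a ^ 3 ^ s) ^ i by
        rw [mul_assoc, mul_assoc, mul_assoc, ← zpow_add (c ^ 3 ^ s)]
        rw [add_neg_cancel, zpow_zero, mul_one, ← mul_assoc, ← zpow_add, neg_add_cancel,
          zpow_zero, one_mul]] at h3
  have h1' : Commute a ((b ^ 3 ^ s) ^ j) := by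
    have h2 := ((Commute.refl a).pow_right (3 ^ s)).zpow_right (-i)
    have h3 := (hga.mul_right (hca.zpow_right (-l))).mul_right h2
    rwa [show ((b ^ 3 ^ s) ^ j * (a ^ 3 ^ s) ^ i * (c ^ 3 ^ s) ^ l *
      (c ^ 3 ^ s) ^ (-l) * (a ^ 3 ^ s) ^ (-i)) = (b ^ 3 ^ s) ^ j by
        rw [mul_assoc _ ((c ^ 3 ^ s) ^ l), ← zpow_add (c ^ 3 ^ s), add_neg_cancel, zpow_zero,
          mul_one, mul_assoc, ← zpow_add, add_neg_cancel, zpow_zero, mul_one]] at h3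
  constructor
  · have h4 := zpow_mul_zpow_class_two (k := 1) (hca.pow_left (3 ^ s)) hcb
      (by rw [zpow_one]; exact h.level_left hα ha) i 1
    rw [zpow_one, ← h1.eq, left_eq_mul, one_mul, mul_one] at h4
    exact dvd_of_zpow_eq_one hc3 hc1 h4
  · have h4 := zpow_mul_zpow_class_two (k := -1) (hcb.pow_left (3 ^ s)) hca
      (by rw [zpow_neg_one]; exact h.level_right hα hb) j 1
    rw [zpow_one, ← h1'.eq, left_eq_mul, mul_one, neg_mul, one_mul, zpow_neg, inv_eq_one] at h4
    exact dvd_of_zpow_eq_one hc3 hc1 h4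

end Level
end MacRel

namespace ThreePair

variable {G : Type*} [Group G] {α : ℤ} {A B C : G} {s : ℕ}

section Quotients

variable {Q : Type*} [Group Q]

theorem map_closure_triple (f : G →* Q) (x y z : G) {g : G}
    (hg : g ∈ Subgroup.closure {x, y, z}) : f g ∈ Subgroup.closure {f x, f y, f z} := by
  have := Subgroup.mem_map_of_mem f hg
  rwa [MonoidHom.map_closure, Set.image_insert_eq, Set.image_pair] at this

theorem one_of_mem {K : Subgroup G} [K.Normal] {g : G} {n : ℕ} (hg : g ^ n ∈ K) :
    QuotientGroup.mk' K g ^ n = 1 := by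
  rw [← map_pow]; exact (QuotientGroup.eq_one_iff _).mpr hg

end Quotients

theorem commuteMod_powSub (h : ThreePair α A B C) {g : G} (hg : g ∈ midSub A B C s) :
    CommuteMod (powSub A B C (s + 1)) A g ∧ CommuteMod (powSub A B C (s + 1)) B g := by
  have hn := h.normal_powSub (s + 1)
  set K := powSub A B C (s + 1) with hK
  set f := QuotientGroup.mk' K with hf
  have hA : f A ^ 3 ^ (s + 1) = 1 := one_of_mem left_mem_powSub
  have hB : f B ^ 3 ^ (s + 1) = 1 := one_of_mem right_mem_powSub
  have hrel := h.rel.map f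
  rw [commuteMod_iff, commuteMod_iff, ← hf]
  have hle : midSub A B C s ≤ (Subgroup.centralizer {f A, f B}).comap f := by
    rw [midSub, Subgroup.closure_le]
    rintro x (rfl | rfl | rfl) <;>
      simp only [Subgroup.coe_comap, Set.mem_preimage, SetLike.mem_coe, map_pow, hA, hB, one_mem]
    rw [Subgroup.mem_centralizer_iff]
    rintro y (rfl | rfl)
    exacts [hrel.level_commute_left h.mod hA, hrel.level_commute_right h.mod hB]
  have := Subgroup.mem_centralizer_iff.mp (hle hg)
  exact ⟨this _ (by simp), this _ (by simp)⟩

theorem commuteMod_midSub (h : ThreePair α A B C) {g : G} (hg : g ∈ powSub A B C s) :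
    CommuteMod (midSub A B C s) A g ∧ CommuteMod (midSub A B C s) B g := by
  have hn := h.normal_midSub s
  set K := midSub A B C s with hK
  set f := QuotientGroup.mk' K with hf
  have hA : f A ^ 3 ^ (s + 1) = 1 := one_of_mem left_mem_midSub
  have hB : f B ^ 3 ^ (s + 1) = 1 := one_of_mem right_mem_midSub
  have hC : f C ^ 3 ^ s = 1 := one_of_mem comm_mem_midSub
  have hrel := h.rel.map f
  rw [commuteMod_iff, commuteMod_iff, ← hf]
  have hle : powSub A B C s ≤ (Subgroup.centralizer {f A, f B}).comap f := by
    rw [powSub, Subgroup.closure_le]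
    rintro x (rfl | rfl | rfl) <;>
      simp only [Subgroup.coe_comap, Set.mem_preimage, SetLike.mem_coe, map_pow, hC, one_mem]
    all_goals
      rw [Subgroup.mem_centralizer_iff]
      rintro y (rfl | rfl)
    · exact (Commute.refl _).pow_right _
    · have := hrel.level_left h.mod hA
      rw [hC, mul_one] at this
      exact this.symm
    · have := hrel.level_right h.mod hB
      rw [hC, inv_one, mul_one] at this
      exact this.symm
    · exact (Commute.refl _).pow_right _
  have := Subgroup.mem_centralizer_iff.mp (hle hg)
  exact ⟨this _ (by simp), this _ (by simp)⟩

/-- The factor of two consecutive `powSub` terms has class at most two and is generated by elements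
of order dividing 3. -/
theorem cube_mem (h : ThreePair α A B C) {g : G} (hg : g ∈ powSub A B C s) :
    g ^ 3 ∈ powSub A B C (s + 1) := by
  have hn := h.normal_powSub (s + 1)
  set K := powSub A B C (s + 1) with hK
  set f := QuotientGroup.mk' K with hf
  have hA : f A ^ 3 ^ (s + 1) = 1 := one_of_mem left_mem_powSub
  have hB : f B ^ 3 ^ (s + 1) = 1 := one_of_mem right_mem_powSub
  have hC : f C ^ 3 ^ (s + 1) = 1 := one_of_mem comm_mem_powSub
  have hrel := h.rel.map f
  have hg' := map_closure_triple f _ _ _ hg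
  rw [map_pow, map_pow, map_pow] at hg'
  rw [← QuotientGroup.eq_one_iff]
  have := cube_eq_one_class_two ((hrel.level_commute_left h.mod hA).pow_left (3 ^ s))
    ((hrel.level_commute_right h.mod hB).pow_left (3 ^ s)) (hrel.level_pow h.mod hA hB)
    (by rw [← pow_mul, ← pow_succ, hA]) (by rw [← pow_mul, ← pow_succ, hB])
    (by rw [← pow_mul, ← pow_succ, hC]) hg'
  rwa [← map_pow] at this

/-- Elements of `powSub A B C s` in normal form modulo `powSub A B C (s + 1)`. -/
theorem exists_form (h : ThreePair α A B C) {g : G} (hg : g ∈ powSub A B C s) :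
    ∃ i j l : ℤ, ((B ^ 3 ^ s) ^ j * (A ^ 3 ^ s) ^ i * (C ^ 3 ^ s) ^ l)⁻¹ * g ∈
      powSub A B C (s + 1) := by
  have hn := h.normal_powSub (s + 1)
  set K := powSub A B C (s + 1) with hK
  set f := QuotientGroup.mk' K with hf
  have hA : f A ^ 3 ^ (s + 1) = 1 := one_of_mem left_mem_powSub
  have hB : f B ^ 3 ^ (s + 1) = 1 := one_of_mem right_mem_powSub
  have hrel := h.rel.map f
  have hg' := map_closure_triple f _ _ _ hg
  rw [map_pow, map_pow, map_pow] at hg'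
  obtain ⟨i, j, l, hl⟩ := exists_normal_form
    ((hrel.level_commute_left h.mod hA).pow_left (3 ^ s))
    ((hrel.level_commute_right h.mod hB).pow_left (3 ^ s)) (hrel.level_pow h.mod hA hB) hg'
  refine ⟨i, j, l, ?_⟩
  rw [← QuotientGroup.eq_one_iff]
  show f _ = 1
  simp only [map_mul, map_inv, map_pow, map_zpow]
  rw [hl, inv_mul_cancel]

theorem dvd_of_commuteMod (h : ThreePair α A B C) (hC : C ^ 3 ^ s ∉ powSub A B C (s + 1))
    {i j l : ℤ}
    (hgA : CommuteMod (powSub A B C (s + 1)) A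
      ((B ^ 3 ^ s) ^ j * (A ^ 3 ^ s) ^ i * (C ^ 3 ^ s) ^ l))
    (hgB : CommuteMod (powSub A B C (s + 1)) B
      ((B ^ 3 ^ s) ^ j * (A ^ 3 ^ s) ^ i * (C ^ 3 ^ s) ^ l)) : 3 ∣ i ∧ 3 ∣ j := by
  have hn := h.normal_powSub (s + 1)
  set K := powSub A B C (s + 1) with hK
  rw [commuteMod_iff] at hgA hgB
  set f := QuotientGroup.mk' K with hf
  simp only [map_mul, map_zpow, map_pow] at hgA hgB
  refine (h.rel.map f).level_dvd h.mod (s := s) (one_of_mem left_mem_powSub)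
    (one_of_mem right_mem_powSub) (one_of_mem comm_mem_powSub) (fun h0 => hC ?_) hgA hgB
  rw [← map_pow] at h0
  exact (QuotientGroup.eq_one_iff _).mp h0

theorem CommuteMod.mul_right {K : Subgroup G} [K.Normal] {x y z : G} (hy : CommuteMod K x y)
    (hz : CommuteMod K x z) : CommuteMod K x (y * z) := by
  rw [commuteMod_iff] at *
  rw [map_mul]; exact hy.mul_right hz

theorem CommuteMod.of_mem {K : Subgroup G} [K.Normal] {x y : G} (hy : y ∈ K) :
    CommuteMod K x y := by
  rw [commuteMod_iff, show QuotientGroup.mk' K y = 1 from (QuotientGroup.eq_one_iff _).mpr hy]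
  exact Commute.one_right _

/-- In the normal form `B ^ (3 ^ s j) A ^ (3 ^ s i) C ^ (3 ^ s l)`, commuting with `B` and `A`
forces `3 ∣ i` and `3 ∣ j`, because the commutators are powers of the nontrivial `C ^ 3 ^ s`. -/
theorem mem_midSub_of_commuteMod (h : ThreePair α A B C) (hC : C ^ 3 ^ s ∉ powSub A B C (s + 1))
    {g : G} (hg : g ∈ powSub A B C s) (hgA : CommuteMod (powSub A B C (s + 1)) A g)
    (hgB : CommuteMod (powSub A B C (s + 1)) B g) : g ∈ midSub A B C s := by
  have hn := h.normal_powSub (s + 1)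
  obtain ⟨i, j, l, hm⟩ := h.exists_form hg
  set m := (B ^ 3 ^ s) ^ j * (A ^ 3 ^ s) ^ i * (C ^ 3 ^ s) ^ l with hmdef
  have e : m = g * (m⁻¹ * g)⁻¹ := by group
  obtain ⟨hi, hj⟩ := h.dvd_of_commuteMod hC (i := i) (j := j) (l := l)
    (by rw [← hmdef, e]; exact CommuteMod.mul_right hgA (CommuteMod.of_mem (inv_mem hm)))
    (by rw [← hmdef, e]; exact CommuteMod.mul_right hgB (CommuteMod.of_mem (inv_mem hm)))
  rw [show g = m * (m⁻¹ * g) by group]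
  have hpow : ∀ {x : G}, x ^ 3 ^ (s + 1) ∈ midSub A B C s → ∀ {i : ℤ}, 3 ∣ i →
      (x ^ 3 ^ s) ^ i ∈ midSub A B C s := fun {x} hx {i} hi => by
    refine zpow_mem_of_dvd (n := 3) ?_ hi
    rw [← pow_mul, ← pow_succ]; exact hx
  exact mul_mem (mul_mem (mul_mem (hpow right_mem_midSub hj) (hpow left_mem_midSub hi))
    (zpow_mem comm_mem_midSub l)) (powSub_succ_le hm)

/-- Modulo `midSub` the commutator of `A` with `C ^ (3 ^ s l)` is `A ^ (3 ^ (s + 1) w l)`, with `3 ∤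
w`, and `A ^ 3 ^ (s + 1)` has order 3 there. -/
theorem dvd_of_commuteMod_zpow (h : ThreePair α A B C)
    (hA1 : A ^ 3 ^ (s + 1) ∉ midSub A B C (s + 1)) {l : ℤ}
    (hl : CommuteMod (midSub A B C (s + 1)) A ((C ^ 3 ^ s) ^ l)) : 3 ∣ l := by
  have hn := h.normal_midSub (s + 1)
  set K := midSub A B C (s + 1) with hK
  rw [commuteMod_iff] at hl
  set f := QuotientGroup.mk' K with hf
  have hrel := h.rel.map f
  have hx3 : (f A ^ 3 ^ (s + 1)) ^ 3 = 1 := by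
    rw [← pow_mul, ← pow_succ]; exact one_of_mem left_mem_midSub
  have hx1 : f A ^ 3 ^ (s + 1) ≠ 1 := fun h0 => hA1 <| by
    rw [← map_pow] at h0
    exact (QuotientGroup.eq_one_iff _).mp h0
  have hC3 : f C ^ 3 ^ (s + 1) = 1 := one_of_mem comm_mem_midSub
  have hA3 : f A ^ 3 ^ (s + 1 + 1) = 1 := one_of_mem left_mem_midSub
  obtain ⟨w, hw, hw3⟩ := exists_pow_eq h.mod s
  have h1 := MacRel.zpow_mul_pow hrel.left 1 (3 ^ s)
  rw [zpow_one, one_mul, hw, zpow_one_add, zpow_mul, zpow_natCast, ← mul_assoc] at h1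
  have hxc : Commute (f C ^ 3 ^ s) (f A ^ 3 ^ (s + 1)) := by
    have h3 := MacRel.zpow_mul_pow hrel.left (3 ^ (s + 1) : ℕ) (3 ^ s)
    rw [hw, mul_one_add, zpow_add, zpow_natCast, ← mul_assoc, zpow_mul, zpow_mul, zpow_natCast,
      zpow_natCast, ← pow_mul, show 3 ^ (s + 1) * 3 ^ (s + 1) = 3 ^ (s + 1 + 1) * 3 ^ s by ring,
      pow_mul, hA3, one_pow, one_zpow, mul_one] at h3
    exact h3.symm
  have h4 := zpow_mul_zpow_class_two ((Commute.refl (f A)).pow_right (3 ^ (s + 1))) hxc h1 1 l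
  rw [map_zpow, map_pow] at hl
  rw [zpow_one, hl.eq, left_eq_mul, one_mul] at h4
  rcases Int.prime_three.dvd_or_dvd (dvd_of_zpow_eq_one hx3 hx1 h4) with h5 | h5
  · exact absurd h5 hw3
  · exact h5

theorem mem_powSub_of_commuteMod (h : ThreePair α A B C)
    (hA1 : A ^ 3 ^ (s + 1) ∉ midSub A B C (s + 1)) {g : G} (hg : g ∈ midSub A B C s)
    (hgA : CommuteMod (midSub A B C (s + 1)) A g) : g ∈ powSub A B C (s + 1) := by
  have hn := h.normal_powSub (s + 1)
  have hn' := h.normal_midSub (s + 1)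
  obtain ⟨l, hl⟩ : ∃ l : ℤ, ((C ^ 3 ^ s) ^ l)⁻¹ * g ∈ powSub A B C (s + 1) := by
    set f := QuotientGroup.mk' (powSub A B C (s + 1)) with hf
    have hg' := map_closure_triple f _ _ _ hg
    rw [map_pow, map_pow, one_of_mem left_mem_powSub, one_of_mem right_mem_powSub,
      Subgroup.closure_insert_one, Subgroup.closure_insert_one] at hg'
    obtain ⟨l, hl⟩ := Subgroup.mem_closure_singleton.mp hg'
    refine ⟨l, (QuotientGroup.eq_one_iff _).mp ?_⟩
    show f _ = 1
    rw [map_mul, map_inv, map_zpow, hl, inv_mul_cancel]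
  obtain ⟨hm, -⟩ := h.commuteMod_midSub hl
  have h1 : CommuteMod (midSub A B C (s + 1)) A ((C ^ 3 ^ s) ^ l) := by
    rw [commuteMod_iff] at hm hgA ⊢
    rw [map_mul, map_inv] at hm
    have := hgA.mul_right hm.inv_right
    rwa [mul_inv_rev, inv_inv, mul_inv_cancel_left] at this
  rw [show g = (C ^ 3 ^ s) ^ l * (((C ^ 3 ^ s) ^ l)⁻¹ * g) by group]
  refine mul_mem (zpow_mem_of_dvd (n := 3) ?_ (h.dvd_of_commuteMod_zpow hA1 h1)) hl
  rw [← pow_mul, ← pow_succ]; exact comm_mem_powSub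

/-- Otherwise `C ^ 3 ^ s` would commute with `A` modulo `midSub`. Together with `left_not_mem` this
carries properness up the chain. -/
theorem comm_not_mem (h : ThreePair α A B C) (hA1 : A ^ 3 ^ (s + 1) ∉ midSub A B C (s + 1)) :
    C ^ 3 ^ s ∉ powSub A B C (s + 1) := by
  intro h0
  have h1 := h.dvd_of_commuteMod_zpow hA1 (l := 1)
    (by rw [zpow_one]; exact (h.commuteMod_midSub h0).1)
  omega

/-- Otherwise `A ^ 3 ^ s` would commute with `B` modulo `powSub`, although their commutator is `C ^
3 ^ s`. -/
theorem left_not_mem (h : ThreePair α A B C) (hC : C ^ 3 ^ s ∉ powSub A B C (s + 1)) :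
    A ^ 3 ^ s ∉ midSub A B C s := by
  intro h0
  have hn := h.normal_powSub (s + 1)
  obtain ⟨-, h1⟩ := h.commuteMod_powSub h0
  set K := powSub A B C (s + 1) with hK
  rw [commuteMod_iff] at h1
  set f := QuotientGroup.mk' K with hf
  have h2 := (h.rel.map f).level_left h.mod (s := s) (one_of_mem left_mem_powSub)
  rw [map_pow] at h1
  rw [← h1.eq, left_eq_mul, ← map_pow] at h2
  exact hC ((QuotientGroup.eq_one_iff _).mp h2)

end ThreePair
end MacdonaldGroup

/-! ### Upper central series, its factors, and exponents -/

namespace MacdonaldGroup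

section ZModPowers

variable {Q : Type*} [Group Q]

theorem pow_val_add {x : Q} (hx : x ^ 3 = 1) (u v : ZMod 3) :
    x ^ (u + v).val = x ^ u.val * x ^ v.val := by
  rw [ZMod.val_add, ← pow_eq_pow_mod _ hx, pow_add]

theorem pow_val_mul {x : Q} (hx : x ^ 3 = 1) (u v : ZMod 3) :
    x ^ (u * v).val = x ^ (u.val * v.val) := by
  rw [ZMod.val_mul, ← pow_eq_pow_mod _ hx]

theorem pow_val_intCast {x : Q} (hx : x ^ 3 = 1) (i : ℤ) : x ^ (i : ZMod 3).val = x ^ i := by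
  rw [← zpow_natCast, ZMod.val_intCast]
  exact zpow_congr hx (Int.mod_modEq i 3).symm.dvd

theorem eq_zero_of_dvd_val {u : ZMod 3} (h : (3 : ℤ) ∣ u.val) : u = 0 := by
  have := ZMod.val_lt u
  exact (ZMod.val_eq_zero u).mp (by omega)

variable {x y c : Q}

/-- With coordinates read from `y ^ b x ^ a c ^ c'`, the product rule of `mul_normal_form` for `k =
1` is that of `Heis`. -/
theorem nonempty_heis_mulEquiv (hx : x ^ 3 = 1) (hy : y ^ 3 = 1) (hc : c ^ 3 = 1)
    (hxc : Commute x c) (hyc : Commute y c) (h : x * y = y * x * c)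
    (hform : ∀ g : Q, ∃ i j l : ℤ, g = y ^ j * x ^ i * c ^ l)
    (huniq : ∀ i j l : ℤ, y ^ j * x ^ i * c ^ l = 1 → 3 ∣ i ∧ 3 ∣ j ∧ 3 ∣ l) :
    Nonempty (Q ≃* Heis (ZMod 3)) := by
  let φ : Heis (ZMod 3) →* Q := MonoidHom.mk'
    (fun g => y ^ g.b.val * x ^ g.a.val * c ^ g.c.val) fun g g' => by
      have h1 := mul_normal_form (k := 1) hxc hyc (by rwa [zpow_one]) g.a.val g.b.val g.c.val
        g'.a.val g'.b.val g'.c.val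
      simp only [zpow_natCast, zpow_add, one_mul, ← Nat.cast_mul] at h1
      rw [h1, Heis.mul_def]
      simp only
      rw [pow_val_add hy, pow_val_add hx, pow_val_add hc, pow_val_add hc, pow_val_mul hc]
  refine ⟨(MulEquiv.ofBijective φ ⟨?_, fun g => ?_⟩).symm⟩
  · rw [injective_iff_map_eq_one]
    intro g hg
    obtain ⟨h1, h2, h3⟩ := huniq g.a.val g.b.val g.c.val
      (by simp only [zpow_natCast]; exact hg)
    exact Heis.ext (eq_zero_of_dvd_val h1) (eq_zero_of_dvd_val h2) (eq_zero_of_dvd_val h3)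
  · obtain ⟨i, j, l, rfl⟩ := hform g
    refine ⟨⟨i, j, l⟩, ?_⟩
    show y ^ (j : ZMod 3).val * x ^ (i : ZMod 3).val * c ^ (l : ZMod 3).val = _
    rw [pow_val_intCast hx, pow_val_intCast hy, pow_val_intCast hc]

theorem nonempty_elementary_mulEquiv (hx : x ^ 3 = 1) (hy : y ^ 3 = 1) (hc : c ^ 3 = 1)
    (hxc : Commute x c) (hyc : Commute y c) (h : Commute x y)
    (hform : ∀ g : Q, ∃ i j l : ℤ, g = y ^ j * x ^ i * c ^ l)
    (huniq : ∀ i j l : ℤ, y ^ j * x ^ i * c ^ l = 1 → 3 ∣ i ∧ 3 ∣ j ∧ 3 ∣ l) :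
    Nonempty (Q ≃* Multiplicative (Fin 3 → ZMod 3)) := by
  let φ : Multiplicative (Fin 3 → ZMod 3) →* Q := MonoidHom.mk'
    (fun g => y ^ (g.toAdd 1).val * x ^ (g.toAdd 0).val * c ^ (g.toAdd 2).val) fun g g' => by
      have h1 := mul_normal_form (k := 0) hxc hyc (by rw [zpow_zero, mul_one]; exact h)
        (g.toAdd 0).val (g.toAdd 1).val (g.toAdd 2).val (g'.toAdd 0).val (g'.toAdd 1).val
        (g'.toAdd 2).val
      simp only [zpow_natCast, zpow_add, zero_mul, zpow_zero, mul_one] at h1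
      rw [h1]
      simp only [toAdd_mul, Pi.add_apply]
      rw [pow_val_add hy, pow_val_add hx, pow_val_add hc]
  refine ⟨(MulEquiv.ofBijective φ ⟨?_, fun g => ?_⟩).symm⟩
  · rw [injective_iff_map_eq_one]
    intro g hg
    obtain ⟨h1, h2, h3⟩ := huniq (g.toAdd 0).val (g.toAdd 1).val (g.toAdd 2).val
      (by simp only [zpow_natCast]; exact hg)
    refine Multiplicative.toAdd.injective (funext fun i => ?_)
    fin_cases i
    exacts [eq_zero_of_dvd_val h1, eq_zero_of_dvd_val h2, eq_zero_of_dvd_val h3]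
  · obtain ⟨i, j, l, rfl⟩ := hform g
    refine ⟨Multiplicative.ofAdd ![i, j, l], ?_⟩
    show y ^ (j : ZMod 3).val * x ^ (i : ZMod 3).val * c ^ (l : ZMod 3).val = _
    rw [pow_val_intCast hx, pow_val_intCast hy, pow_val_intCast hc]

end ZModPowers

namespace ThreePair

variable {G : Type*} [Group G] {α : ℤ} {A B C : G} {s : ℕ}

theorem powSub_zero (h : ThreePair α A B C) : powSub A B C 0 = ⊤ := by
  rw [eq_top_iff, ← h.gen, Subgroup.closure_le]
  intro x hx
  simp only [Set.mem_insert_iff, Set.mem_singleton_iff] at hx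
  rcases hx with hx | hx <;> rw [hx]
  · simpa using (left_mem_powSub : A ^ 3 ^ 0 ∈ powSub A B C 0)
  · simpa using (right_mem_powSub : B ^ 3 ^ 0 ∈ powSub A B C 0)

theorem midSub_three (h : ThreePair α A B C) : midSub A B C 3 = ⊥ := by
  rw [eq_bot_iff, midSub, Subgroup.closure_le]
  rintro x (rfl | rfl | rfl)
  exacts [h.left_order, h.right_order, h.comm_order]

theorem powSub_three (h : ThreePair α A B C) : powSub A B C 3 = Subgroup.closure {A ^ 27} := by
  refine le_antisymm ?_ ?_
  · rw [powSub, Subgroup.closure_le]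
    rintro x (rfl | rfl | rfl)
    · exact Subgroup.subset_closure rfl
    · have : B ^ 27 = (A ^ 27)⁻¹ := eq_inv_of_mul_eq_one_right h.mul_eq
      show B ^ 27 ∈ _
      rw [this]
      exact inv_mem (Subgroup.subset_closure rfl)
    · show C ^ 27 ∈ _
      rw [h.comm_order]; exact one_mem _
  · rw [Subgroup.closure_le]
    rintro x rfl
    exact left_mem_powSub (s := 3)

theorem pow_mem_powSub (h : ThreePair α A B C) (s : ℕ) (g : G) : g ^ 3 ^ s ∈ powSub A B C s := by
  induction s with
  | zero => rw [h.powSub_zero]; trivial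
  | succ s ih => rw [pow_succ, pow_mul]; exact h.cube_mem ih

theorem powerSubgroup_eq (h : ThreePair α A B C) (s : ℕ) :
    powerSubgroup G (3 ^ s) = powSub A B C s := by
  refine le_antisymm ?_ ?_
  · rw [powerSubgroup, Subgroup.closure_le]
    rintro _ ⟨g, rfl⟩
    exact h.pow_mem_powSub s g
  · rw [powSub, Subgroup.closure_le]
    rintro _ (rfl | rfl | rfl)
    exacts [Subgroup.subset_closure ⟨A, rfl⟩, Subgroup.subset_closure ⟨B, rfl⟩,
      Subgroup.subset_closure ⟨C, rfl⟩]

/-- If `A ^ 27 = 1`, then `powSub A B C 3`, which contains all 27th powers, is trivial. So one pair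
with `A ^ 27 ≠ 1` settles every pair. -/
theorem left_pow_ne_one (h : ThreePair α A B C) {g : G} (hg : g ^ 27 ≠ 1) : A ^ 27 ≠ 1 := by
  intro h0
  have h1 := h.pow_mem_powSub 3 g
  rw [h.powSub_three, h0, Subgroup.closure_singleton_one] at h1
  exact hg h1

theorem not_mem (h : ThreePair α A B C) (hA : A ^ 27 ≠ 1) :
    (∀ t < 3, A ^ 3 ^ (t + 1) ∉ midSub A B C (t + 1)) ∧
      ∀ t < 3, C ^ 3 ^ t ∉ powSub A B C (t + 1) := by
  have a3 : A ^ 3 ^ (2 + 1) ∉ midSub A B C (2 + 1) := by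
    rw [h.midSub_three]; exact hA
  have c2 := h.comm_not_mem a3
  have a2 := h.left_not_mem c2
  have c1 := h.comm_not_mem (s := 1) a2
  have a1 := h.left_not_mem c1
  have c0 := h.comm_not_mem (s := 0) a1
  constructor <;> intro t ht <;> interval_cases t
  exacts [a1, a2, a3, c0, c1, c2]

theorem mem_powSub_of_central (h : ThreePair α A B C) (hA : A ^ 27 ≠ 1) {g : G} :
    ∀ t ≤ 3, CommuteMod (midSub A B C t) A g → CommuteMod (midSub A B C t) B g →
      g ∈ powSub A B C t := by
  intro t
  induction t with
  | zero => intro _ _ _; rw [h.powSub_zero]; trivial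
  | succ t ih =>
    intro ht h1 h2
    have h3 : midSub A B C (t + 1) ≤ powSub A B C (t + 1) := midSub_le
    have h4 : powSub A B C (t + 1) ≤ midSub A B C t := powSub_succ_le
    -- Centrality modulo a smaller term implies centrality modulo each larger one, so `g` descends
    -- the chain one step at a time.
    have h5 := ih (by omega) (h1.mono (h3.trans h4)) (h2.mono (h3.trans h4))
    have h6 := h.mem_midSub_of_commuteMod ((h.not_mem hA).2 t (by omega)) h5 (h1.mono h3)
      (h2.mono h3)
    exact h.mem_powSub_of_commuteMod ((h.not_mem hA).1 t (by omega)) h6 h1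

theorem mem_midSub_of_central (h : ThreePair α A B C) (hA : A ^ 27 ≠ 1) {g : G} {t : ℕ}
    (ht : t < 3) (h1 : CommuteMod (powSub A B C (t + 1)) A g)
    (h2 : CommuteMod (powSub A B C (t + 1)) B g) : g ∈ midSub A B C t :=
  h.mem_midSub_of_commuteMod ((h.not_mem hA).2 t ht)
    (h.mem_powSub_of_central hA t ht.le (h1.mono powSub_succ_le) (h2.mono powSub_succ_le)) h1 h2

theorem ucs_of_midSub (h : ThreePair α A B C) (hA : A ^ 27 ≠ 1) {n t : ℕ} (ht : t ≤ 3)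
    (hn : Subgroup.upperCentralSeries G n = midSub A B C t) :
    Subgroup.upperCentralSeries G (n + 1) = powSub A B C t := by
  ext g
  rw [mem_upperCentralSeries_succ h.gen hn]
  exact ⟨fun hg => h.mem_powSub_of_central hA t ht hg.1 hg.2, h.commuteMod_midSub⟩

theorem ucs_of_powSub (h : ThreePair α A B C) (hA : A ^ 27 ≠ 1) {n t : ℕ} (ht : t < 3)
    (hn : Subgroup.upperCentralSeries G n = powSub A B C (t + 1)) :
    Subgroup.upperCentralSeries G (n + 1) = midSub A B C t := by
  ext g
  rw [mem_upperCentralSeries_succ h.gen hn]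
  exact ⟨fun hg => h.mem_midSub_of_central hA ht hg.1 hg.2, h.commuteMod_powSub⟩

theorem upperCentralSeries_eq (h : ThreePair α A B C) (hA : A ^ 27 ≠ 1) :
    Subgroup.upperCentralSeries G 1 = powSub A B C 3 ∧
    Subgroup.upperCentralSeries G 3 = powSub A B C 2 ∧
    Subgroup.upperCentralSeries G 5 = powSub A B C 1 := by
  have h1 := h.ucs_of_midSub hA (n := 0) le_rfl h.midSub_three.symm
  have h2 := h.ucs_of_powSub hA (t := 2) (by norm_num) h1
  have h3 := h.ucs_of_midSub hA (by norm_num) h2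
  have h4 := h.ucs_of_powSub hA (t := 1) (by norm_num) h3
  exact ⟨h1, h3, h.ucs_of_midSub hA (by norm_num) h4⟩

theorem dvd_of_mem (h : ThreePair α A B C) (hA : A ^ 27 ≠ 1) {t : ℕ} (ht : t < 3) {i j l : ℤ}
    (hm : (B ^ 3 ^ t) ^ j * (A ^ 3 ^ t) ^ i * (C ^ 3 ^ t) ^ l ∈ powSub A B C (t + 1)) :
    3 ∣ i ∧ 3 ∣ j ∧ 3 ∣ l := by
  have hn := h.normal_powSub (t + 1)
  have hC := (h.not_mem hA).2 t ht
  obtain ⟨hi, hj⟩ := h.dvd_of_commuteMod hC (CommuteMod.of_mem hm) (CommuteMod.of_mem hm)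
  refine ⟨hi, hj, ?_⟩
  have hpow : ∀ {x : G}, x ^ 3 ^ (t + 1) ∈ powSub A B C (t + 1) → ∀ {i : ℤ}, 3 ∣ i →
      (x ^ 3 ^ t) ^ i ∈ powSub A B C (t + 1) := fun {x} hx {i} hi => by
    refine zpow_mem_of_dvd (n := 3) ?_ hi
    rw [← pow_mul, ← pow_succ]; exact hx
  have h1 := (Subgroup.mul_mem_cancel_left _
    (mul_mem (hpow right_mem_powSub hj) (hpow left_mem_powSub hi))).mp hm
  have h2 : (QuotientGroup.mk' (powSub A B C (t + 1)) C ^ 3 ^ t) ^ l = 1 := by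
    rw [← map_pow, ← map_zpow]; exact (QuotientGroup.eq_one_iff _).mpr h1
  refine dvd_of_zpow_eq_one ?_ (fun h3 => hC ?_) h2
  · rw [← pow_mul, ← pow_succ]; exact one_of_mem comm_mem_powSub
  · rw [← map_pow] at h3; exact (QuotientGroup.eq_one_iff _).mp h3

/-- A subgroup `K` with an equation, rather than `powSub` itself, lets the upper central term be
used with its own normality instance. -/
theorem nonempty_quotient_heis (h : ThreePair α A B C) (hA : A ^ 27 ≠ 1) (K : Subgroup G)
    [K.Normal] (hK : K = powSub A B C 1) : Nonempty (G ⧸ K ≃* Heis (ZMod 3)) := by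
  set f := QuotientGroup.mk' K with hf
  have hAf : f A ^ 3 ^ (0 + 1) = 1 := one_of_mem (hK ▸ left_mem_powSub)
  have hBf : f B ^ 3 ^ (0 + 1) = 1 := one_of_mem (hK ▸ right_mem_powSub)
  have hCf : f C ^ 3 ^ (0 + 1) = 1 := one_of_mem (hK ▸ comm_mem_powSub)
  have hrel := h.rel.map f
  refine nonempty_heis_mulEquiv (x := f A) (y := f B) (c := f C) hAf hBf hCf
    (by simpa using hrel.level_commute_left (s := 0) h.mod hAf)
    (by simpa using hrel.level_commute_right (s := 0) h.mod hBf) hrel.comm (fun q => ?_)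
    fun i j l hl => ?_
  · obtain ⟨g, rfl⟩ := QuotientGroup.mk'_surjective K q
    obtain ⟨i, j, l, hm⟩ := h.exists_form (s := 0) (g := g) (by rw [h.powSub_zero]; trivial)
    refine ⟨i, j, l, ?_⟩
    simp only [pow_zero, pow_one] at hm
    rw [← hf, ← map_zpow, ← map_zpow, ← map_zpow, ← map_mul, ← map_mul, eq_comm]
    exact QuotientGroup.eq.mpr (hK ▸ hm)
  · refine h.dvd_of_mem hA (t := 0) (by norm_num) ?_
    simp only [pow_zero, pow_one]
    rw [← map_zpow, ← map_zpow, ← map_zpow, ← map_mul, ← map_mul] at hl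
    have := (QuotientGroup.eq_one_iff _).mp hl
    rwa [hK] at this

theorem nonempty_quotient_elementary (h : ThreePair α A B C) (hA : A ^ 27 ≠ 1)
    (K L : Subgroup G) [L.Normal] (hK : K = powSub A B C 1) (hL : L = powSub A B C 2) :
    Nonempty (K ⧸ L.subgroupOf K ≃* Multiplicative (Fin 3 → ZMod 3)) := by
  set f := QuotientGroup.mk' (L.subgroupOf K) with hf
  have hf1 : ∀ u : K, f u = 1 ↔ (u : G) ∈ L := fun u =>
    (QuotientGroup.eq_one_iff u).trans Subgroup.mem_subgroupOf
  have hcm : ∀ {u v : K}, CommuteMod L (u : G) v → Commute (f u) (f v) := fun {u v} huv => by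
    rw [commute_iff_eq, ← map_mul, ← map_mul]
    exact QuotientGroup.eq.mpr (Subgroup.mem_subgroupOf.mpr huv)
  have hAf : QuotientGroup.mk' L A ^ 3 ^ (1 + 1) = 1 := one_of_mem (hL ▸ left_mem_powSub)
  have hBf : QuotientGroup.mk' L B ^ 3 ^ (1 + 1) = 1 := one_of_mem (hL ▸ right_mem_powSub)
  have hCf : QuotientGroup.mk' L C ^ 3 ^ (1 + 1) = 1 := one_of_mem (hL ▸ comm_mem_powSub)
  have hrel := h.rel.map (QuotientGroup.mk' L)
  have hcAC : CommuteMod L (A ^ 3) (C ^ 3) := by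
    rw [commuteMod_iff, map_pow, map_pow]
    exact (hrel.level_commute_left (s := 1) h.mod hAf).pow_left 3
  have hcBC : CommuteMod L (B ^ 3) (C ^ 3) := by
    rw [commuteMod_iff, map_pow, map_pow]
    exact (hrel.level_commute_right (s := 1) h.mod hBf).pow_left 3
  have hcAB : CommuteMod L (A ^ 3) (B ^ 3) := by
    rw [commuteMod_iff, map_pow, map_pow]
    have := hrel.level_pow (s := 1) h.mod hAf hBf
    rw [zpow_natCast, ← pow_mul, show 3 ^ 1 * 3 ^ 1 = 3 ^ (1 + 1) by norm_num, hCf,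
      mul_one] at this
    exact this
  let x : K := ⟨A ^ 3, hK ▸ left_mem_powSub (s := 1)⟩
  let y : K := ⟨B ^ 3, hK ▸ right_mem_powSub (s := 1)⟩
  let c : K := ⟨C ^ 3, hK ▸ comm_mem_powSub (s := 1)⟩
  have cube : ∀ u : K, f u ^ 3 = 1 := fun u => by
    rw [← map_pow, hf1, hL]
    exact h.cube_mem (hK ▸ u.2)
  refine nonempty_elementary_mulEquiv (x := f x) (y := f y) (c := f c) (cube x) (cube y) (cube c)
    (hcm hcAC) (hcm hcBC) (hcm hcAB) (fun q => ?_) fun i j l hl => ?_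
  · obtain ⟨g, rfl⟩ := QuotientGroup.mk'_surjective _ q
    obtain ⟨i, j, l, hm⟩ := h.exists_form (s := 1) (g := (g : G)) (hK ▸ g.2)
    refine ⟨i, j, l, ?_⟩
    rw [← hf, ← map_zpow, ← map_zpow, ← map_zpow, ← map_mul, ← map_mul, eq_comm]
    refine QuotientGroup.eq.mpr (Subgroup.mem_subgroupOf.mpr ?_)
    rw [hL]; exact hm
  · refine h.dvd_of_mem hA (t := 1) (by norm_num) ?_
    rw [← map_zpow, ← map_zpow, ← map_zpow, ← map_mul, ← map_mul, hf1, hL] at hl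
    exact hl

/-- Conjugation by `B ^ 9` sends `A` to `A w C ^ 9` with `w` central and `w ^ 9 = 1`, and `(A C ^ 9)
^ 9 = A ^ 9`. -/
theorem commute_pow_nine (h : ThreePair α A B C) : Commute (A ^ 9) (B ^ 9) := by
  have hp : ∀ p : ℕ, p.Prime → p ∣ 9 → (p : ℤ) ∣ α - 1 := fun p h1 h2 =>
    prime_dvd_sub_one_of_pow h.mod (s := 2) p h1 h2
  obtain ⟨r, hr⟩ : (27 : ℤ) ∣ defect α 9 := dvd_defect_pow h.mod 2
  obtain ⟨t, ht⟩ : (27 : ℤ) ∣ α ^ 9 - 1 := h.dvd_pow_sub_one 2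
  have hcent : ∀ g, Commute g (B ^ 27) := by
    have h1 : B ^ 27 = (A ^ 27)⁻¹ := eq_inv_of_mul_eq_one_right h.mul_eq
    exact commute_of_closure_eq_top h.gen (h1 ▸ ((Commute.refl A).pow_right 27).inv_right)
      ((Commute.refl B).pow_right 27)
  set w := B ^ (-defect α 9) with hw
  have hw' : w = (B ^ 27) ^ (-r) := by
    rw [hw, hr, ← zpow_natCast, ← zpow_mul]; congr 1; push_cast; ring
  have hwc : ∀ g, Commute g w := fun g => hw' ▸ (hcent g).zpow_right _
  have hw9 : w ^ 9 = 1 := by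
    rw [hw', ← zpow_natCast, ← zpow_mul, ← zpow_natCast, ← zpow_mul]
    refine (zpow_congr (M := 81) h.right_order (y := 0) ⟨-(3 * r), ?_⟩).trans (zpow_zero _)
    push_cast; ring
  have hC9 : (C ^ 9) ^ 9 = 1 := by
    rw [← pow_mul, show 9 * 9 = 27 * 3 from rfl, pow_mul, h.comm_order, one_pow]
  -- `C ^ 9` acts on `A` with `α ^ 9` in place of `α`; as `α ^ 9 ≡ 1 mod 27`, the resulting exponent
  -- of `A` is 9 modulo 81.
  have hAC : (A * C ^ 9) ^ 9 = A ^ 9 := by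
    have h1 : A * C ^ 9 = C ^ 9 * A ^ α ^ 9 := by
      have := MacRel.zpow_mul_pow h.rel.left 1 9
      rwa [zpow_one, one_mul] at this
    have h2 := MacRel.mul_pow_eq h1 1 9
    rw [zpow_one, hC9, one_mul, one_mul] at h2
    rw [h2, ← zpow_natCast A 9]
    refine zpow_congr (M := 81) h.left_order ?_
    obtain ⟨v, hv⟩ := (dvd_geo_and_wgeo (α := α ^ 9) (n := 9) (by norm_num) fun p h1 h2 =>
      modEq_one_of_pow (hp p h1 h2) 9).2
    obtain ⟨d, hd⟩ := modEq_one_of_pow (Dvd.intro t ht.symm : (27 : ℤ) ∣ α ^ 9 - 1) 9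
    have h3 := defect_eq (α ^ 9) 9
    simp only [defect] at h3
    rw [ht] at h3
    have hv2 : ∃ e, wgeo (α ^ 9) 9 = 9 * e := ⟨wgeo (α ^ 9) 9 / 9, by push_cast at hv; omega⟩
    obtain ⟨e, he⟩ := hv2
    refine ⟨3 * d - 3 * t * e, ?_⟩
    push_cast at h3 ⊢
    rw [he] at h3
    linear_combination h3 + 9 * hd
  have h1 := h.rel.mul_pow_right 9
  rw [← hw, mul_assoc A, ← (hwc (C ^ 9)).eq, ← mul_assoc A] at h1
  have h2 := conj_pow (i := 9) (a := (B ^ 9)⁻¹) (b := A)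
  rw [inv_inv, mul_assoc, h1, inv_mul_cancel_left, (hwc _).mul_pow, hw9, mul_one, hAC,
    mul_assoc, eq_inv_mul_iff_mul_eq] at h2
  exact h2.symm

theorem commute_pow_nine_comm (h : ThreePair α A B C) : Commute (A ^ 9) (C ^ 9) := by
  have h1 := MacRel.zpow_mul_pow h.rel.left 9 9
  obtain ⟨t, ht⟩ : (27 : ℤ) ∣ α ^ 9 - 1 := h.dvd_pow_sub_one 2
  rw [zpow_congr (M := 81) h.left_order (x := 9 * α ^ 9) (y := 9)
    ⟨3 * t, by push_cast; linear_combination 9 * ht⟩] at h1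
  exact_mod_cast h1

theorem mul_comm_of_mem (h : ThreePair α A B C) {u v : G} (hu : u ∈ powSub A B C 2)
    (hv : v ∈ powSub A B C 2) : u * v = v * u := by
  have hAB : Commute (A ^ 3 ^ 2) (B ^ 3 ^ 2) := h.commute_pow_nine
  have hAC : Commute (A ^ 3 ^ 2) (C ^ 3 ^ 2) := h.commute_pow_nine_comm
  have hBC : Commute (B ^ 3 ^ 2) (C ^ 3 ^ 2) := by simpa using h.symm.commute_pow_nine_comm
  have hle : powSub A B C 2 ≤ Subgroup.centralizer (powSub A B C 2 : Set G) := by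
    rw [powSub, Subgroup.centralizer_closure, Subgroup.closure_le]
    rintro x (rfl | rfl | rfl) <;> rw [SetLike.mem_coe, Subgroup.mem_centralizer_iff] <;>
      rintro y (rfl | rfl | rfl)
    exacts [rfl, hAB.symm, hAC.symm, hAB, rfl, hBC.symm, hAC, hBC, rfl]
  exact (Subgroup.mem_centralizer_iff.mp (hle hu) v hv).symm

theorem pow_three_eq_one (h : ThreePair α A B C) {g : G} (hg : g ∈ powSub A B C 3) :
    g ^ 3 = 1 := by
  have h1 : powSub A B C (3 + 1) ≤ ⊥ := h.midSub_three ▸ powSub_succ_le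
  exact h1 (h.cube_mem hg)

theorem exponent_eq (h : ThreePair α A B C) (hA : A ^ 27 ≠ 1) : Monoid.exponent G = 81 := by
  refine Nat.dvd_antisymm (Monoid.exponent_dvd_of_forall_pow_eq_one fun g => ?_) ?_
  · rw [show 81 = 3 ^ 3 * 3 from rfl, pow_mul]
    exact h.pow_three_eq_one (h.pow_mem_powSub 3 g)
  · have : orderOf A = 3 ^ (3 + 1) := orderOf_eq_prime_pow hA h.left_order
    exact (show orderOf A = 81 from this) ▸ Monoid.order_dvd_exponent A

theorem exponent_subgroup_eq (h : ThreePair α A B C) (hA : A ^ 27 ≠ 1) (K : Subgroup G)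
    (hK : K = powSub A B C 2) : Monoid.exponent K = 9 := by
  refine Nat.dvd_antisymm (Monoid.exponent_dvd_of_forall_pow_eq_one fun g => Subtype.ext ?_) ?_
  · rw [show 9 = 3 * 3 from rfl, pow_mul]
    exact h.pow_three_eq_one (h.cube_mem (s := 2) (hK ▸ g.2))
  · let x : K := ⟨A ^ 9, hK ▸ left_mem_powSub (s := 2)⟩
    have : orderOf x = 3 ^ (1 + 1) := by
      refine orderOf_eq_prime_pow (fun h0 => hA ?_) (Subtype.ext ?_)
      · have := congrArg Subtype.val h0
        simpa [x, ← pow_mul] using this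
      · show (A ^ 9) ^ 9 = 1
        rw [← pow_mul]; exact h.left_order
    exact (show orderOf x = 9 from this) ▸ Monoid.order_dvd_exponent x

end ThreePair
end MacdonaldGroup

/-! ### The Sylow 3-subgroup of the Macdonald group -/

namespace MacdonaldGroup

theorem nine_dvd_sub_seven {α : ℤ} (hm : padicValInt 3 (α - 1) = 1)
    (hk : (α - 1) / 3 ≡ -1 [ZMOD 3]) : (9 : ℤ) ∣ α - 7 := by
  have h3 : (3 : ℤ) ∣ α - 1 := by
    by_contra h
    rw [padicValInt.eq_zero_of_not_dvd (by exact_mod_cast h)] at hm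
    exact zero_ne_one hm
  have := hk.symm.dvd
  omega

namespace Macdonald

variable (α : ℤ)

/-- The first generator of the Macdonald group. -/
def x : Macdonald α := PresentedGroup.of 0

/-- The second generator of the Macdonald group. -/
def y : Macdonald α := PresentedGroup.of 1

theorem macRel : MacRel α (x α) (y α) (comm (x α) (y α)) := by
  rw [macRel_iff]
  constructor
  · have h : PresentedGroup.mk (relators α)
        (conjBy (FreeGroup.of 0) (comm (FreeGroup.of 0) (FreeGroup.of 1)) *
          (FreeGroup.of 0 ^ α)⁻¹) = 1 := PresentedGroup.one_of_mem (Or.inl rfl)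
    rw [map_mul, map_inv, mul_inv_eq_one] at h
    simp only [conjBy, comm, map_mul, map_inv, map_zpow] at h ⊢
    exact h
  · have h : PresentedGroup.mk (relators α)
        (conjBy (FreeGroup.of 1) (comm (FreeGroup.of 1) (FreeGroup.of 0)) *
          (FreeGroup.of 1 ^ α)⁻¹) = 1 := PresentedGroup.one_of_mem (Or.inr rfl)
    rw [map_mul, map_inv, mul_inv_eq_one] at h
    simp only [conjBy, comm, map_mul, map_inv, map_zpow] at h ⊢
    exact h

theorem closure_eq_top : Subgroup.closure {x α, y α} = ⊤ := by
  rw [← PresentedGroup.closure_range_of (relators α)]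
  congr 1
  ext g
  simp [x, y, Fin.exists_fin_two, eq_comm]

variable {α}

theorem exists_hom {Γ : Type*} [Group Γ] {a b c : Γ} (h : MacRel α a b c) :
    ∃ f : Macdonald α →* Γ, f (x α) = a ∧ f (y α) = b := by
  rw [h.eq_comm, macRel_iff] at h
  refine ⟨PresentedGroup.toGroup (f := ![a, b]) ?_, ?_, ?_⟩
  · rintro r (rfl | rfl)
    · simpa [conjBy, comm, mul_inv_eq_one] using h.1
    · simpa [conjBy, comm, mul_inv_eq_one] using h.2
  · simp [x]
  · simp [y]

/-- The pair consists of the 3-components `x ^ e`, `y ^ e`. The map to the model sends `x ^ e` to an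
element whose 27th power is nontrivial. -/
theorem exists_generatingPair_sylow (hα : (9 : ℤ) ∣ α - 7) (J : Sylow 3 (Macdonald α)) :
    ∃ A B : J, IsGeneratingPair α A B ∧ A ^ 27 ≠ 1 := by
  obtain ⟨M, hM, hxM, hyM, hp⟩ := (macRel α).prime_dvd_sub_one
    (by rcases abs_cases α with h | h <;> omega)
  -- Padding `M` by 81 ensures `81 ∣ 3 ^ N`, hence `e ≡ 1 mod 81`, so that `a ^ e = a` in the model.
  obtain ⟨N, Q, hQ3, hMQ⟩ := Nat.exists_eq_pow_mul_and_not_dvd (n := 81 * M) (by omega) 3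
    (by norm_num)
  have hcop : Nat.Coprime 3 Q := (Nat.Prime.coprime_iff_not_dvd Nat.prime_three).2 hQ3
  have h81 : 81 ∣ 3 ^ N :=
    (Nat.Coprime.pow_left 4 hcop).dvd_of_dvd_mul_right (hMQ ▸ Dvd.intro M rfl)
  obtain ⟨e, he, hrel, hJ⟩ := sylow_eq_closure (macRel α) (closure_eq_top α)
    (hcop.pow_left N) hcop (by rintro rfl; simp at hQ3)
    (by rw [← hMQ, mul_comm, pow_mul, hxM, one_pow])
    (by rw [← hMQ, mul_comm, pow_mul, hyM, one_pow])
    (fun p hpp hpd => by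
      rw [← hMQ] at hpd
      rcases hpp.dvd_mul.1 hpd with h | h
      · have : p = 3 := (Nat.prime_dvd_prime_iff_eq hpp Nat.prime_three).1
          (hpp.dvd_of_dvd_pow (n := 4) h)
        subst this
        push_cast
        omega
      · exact hp p hpp h) J
  have hxJ : x α ^ e ∈ (J : Subgroup (Macdonald α)) := hJ ▸ Subgroup.subset_closure (Or.inl rfl)
  have hyJ : y α ^ e ∈ (J : Subgroup (Macdonald α)) := hJ ▸ Subgroup.subset_closure (Or.inr rfl)
  have hc : comm (x α ^ e) (y α ^ e) = comm (x α) (y α) ^ e := hrel.eq_comm.symm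
  refine ⟨⟨x α ^ e, hxJ⟩, ⟨y α ^ e, hyJ⟩, ?_, fun h0 => ?_⟩
  · have h := MacRel.of_injective (f := (J : Subgroup (Macdonald α)).subtype)
      (A := ⟨x α ^ e, hxJ⟩) (B := ⟨y α ^ e, hyJ⟩)
      (C := comm ⟨x α ^ e, hxJ⟩ ⟨y α ^ e, hyJ⟩) Subtype.val_injective (hc.symm ▸ hrel)
    exact ⟨closure_subtype_eq_top hJ hxJ hyJ, (macRel_iff.1 h).1, (macRel_iff.1 h).2⟩
  · obtain ⟨Γ, _, a, b, c, hΓ, ha, ha'⟩ := exists_model hα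
    obtain ⟨f, hf, -⟩ := exists_hom hΓ
    have hae : a ^ e = a := by
      have := zpow_congr (x := e) (y := 1) ha ((Int.natCast_dvd_natCast.2 h81).trans he)
      simpa using this
    have h1 := congrArg f (congrArg Subtype.val h0)
    simp only [SubmonoidClass.mk_pow, map_pow, hf, hae] at h1
    exact ha' (by simpa using h1)

end Macdonald

end MacdonaldGroup

theorem proposition9p3 (α : ℤ) (hm : padicValInt 3 (α - 1) = 1)
    (hk : (α - 1) / 3 ≡ -1 [ZMOD 3]) (J : Sylow 3 (MacdonaldGroup.Macdonald α)) :
    (∃ A B : J, MacdonaldGroup.IsGeneratingPair α A B) ∧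
    ∀ A B : J, MacdonaldGroup.IsGeneratingPair α A B →
      -- part (a)
      (Subgroup.upperCentralSeries J 5 =
          Subgroup.closure {A ^ 3, B ^ 3, MacdonaldGroup.comm A B ^ 3} ∧
        Subgroup.upperCentralSeries J 5 = MacdonaldGroup.powerSubgroup J 3 ∧
        Nonempty (J ⧸ Subgroup.upperCentralSeries J 5 ≃* MacdonaldGroup.Heis (ZMod 3))) ∧
      -- part (b)
      (Subgroup.upperCentralSeries J 3 =
          Subgroup.closure {A ^ 9, B ^ 9, MacdonaldGroup.comm A B ^ 9} ∧
        Subgroup.upperCentralSeries J 3 = MacdonaldGroup.powerSubgroup J 9 ∧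
        (∀ u ∈ Subgroup.upperCentralSeries J 3, ∀ v ∈ Subgroup.upperCentralSeries J 3,
          u * v = v * u) ∧
        Monoid.exponent (Subgroup.upperCentralSeries J 3) = 9 ∧
        Nonempty (Subgroup.upperCentralSeries J 5 ⧸
            (Subgroup.upperCentralSeries J 3).subgroupOf (Subgroup.upperCentralSeries J 5) ≃*
          Multiplicative (Fin 3 → ZMod 3))) ∧
      -- part (c)
      (Subgroup.center J = Subgroup.closure {A ^ 27} ∧
        Subgroup.center J = MacdonaldGroup.powerSubgroup J 27 ∧
        Monoid.exponent J = 81) := by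
  have hα := MacdonaldGroup.nine_dvd_sub_seven hm hk
  obtain ⟨A₀, B₀, h₀, h27⟩ := MacdonaldGroup.Macdonald.exists_generatingPair_sylow hα J
  refine ⟨⟨A₀, B₀, h₀⟩, fun A B hAB => ?_⟩
  have h := (MacdonaldGroup.macRel_iff.2 ⟨hAB.rel_left, hAB.rel_right⟩).threePair hAB.generate
    J.isPGroup' hα
  have hA := h.left_pow_ne_one h27
  obtain ⟨h1, h3, h5⟩ := h.upperCentralSeries_eq hA
  rw [Subgroup.upperCentralSeries_one] at h1
  refine ⟨⟨h5, h5.trans (h.powerSubgroup_eq 1).symm, h.nonempty_quotient_heis hA _ h5⟩,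
    ⟨h3, h3.trans (h.powerSubgroup_eq 2).symm, fun u hu v hv => ?_,
      h.exponent_subgroup_eq hA _ h3, h.nonempty_quotient_elementary hA _ _ h5 h3⟩,
    h1.trans h.powSub_three, h1.trans (h.powerSubgroup_eq 3).symm, h.exponent_eq hA⟩
  exact h.mul_comm_of_mem (h3 ▸ hu) (h3 ▸ hv)
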